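/- **Setting.** A marriage instance $G=(A\cup B,E)$ is a finite bipartite graph with $n=|A|+|B|$ vertices and $m=|E|$ edges in which every vertex ranks its neighbours strictly; being unmatched is worst. Assume $|A|\ge|B|$. For matchings $M,N$ let $\phi(M,N)$ be the number of vertices preferring their assignment in $M$ to that in $N$. $M$ is *popular* if $\phi(M,N)\ge\phi(N,M)$ for all matchings $N$, and *dominant* if moreover $\phi(M,N)>\phi(N,M)$ for all matchings $N$ with $|N|>|M|$. A vertex is *stable* if it is matched in some stable matching, otherwise *unstable*; it is *popular* if it is matched in some popular matching of maximum size. An edge is popular (dominant) if it lies in some popular (dominant) matching. **The instance $G^*$.** In each connected component with at least two vertices of the subgraph of popular edges of $G$, pair the unstable vertices of $A$ bijectively (and arbitrarily) with the unstable vertices of $B$; pair all vertices of $B$ that form singleton components with distinct vertices of $A$ that form singleton components. $G^*=(A\cup B,E^*)$ is $G$ with all these pairs added as edges, a new neighbour being the least preferred one. Let $U^*$ be the set of unstable vertices of $G^*$ (it is contained in $A$) and $U_A$ the set of vertices of $A$ that are unstable in $G$. **Witnesses.** For a matching $M$ of $G^*$ let $\mathrm{wt}_M(a,b)$ be $2$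 if both $a$ and $b$ prefer each other to their assignments in $M$, $-2$ if both prefer their assignments in $M$, and $0$ otherwise (in particular if $(a,b)\in M$); let $\mathrm{wt}_M(u,u)$ be $-1$ if $u$ is matched in $M$ and $0$ if not. A *witness* of $M$ is a vector $\alpha\in\{0,\pm1\}^{A\cup B}$ with $\sum_u\alpha_u=0$, $\alpha_a+\alpha_b\ge \mathrm{wt}_M(a,b)$ for $(a,b)\in E^*$ and $\alpha_u\ge \mathrm{wt}_M(u,u)$ for all $u$. It is *extra-dominant* if $\alpha_v\in\{\pm1\}$ for every popular vertex $v$ of $G^*$ and $\alpha_a=-1$ for all $a\in U_A\setminus U^*$. A popular matching of $G^*$ is *extra-dominant* if it has an extra-dominant witness; the *extra-dominant matching polytope* of $G^*$ is the convex hull in $\mathbb R^{E^*}$ of the incidence vectors $I_T$ of the extra-dominant matchings $T$. **The polytopes.** For $x\in\mathbb R^{E^*}$ and $(a,b)\in E^*$ put $\mathrm{vote}_a(b,x)=\bigl(1-\sum_{e\in\delta^*(a)}x_e\bigr)+\sum_{b'\prec_a b}x_{(a,b')}-\sum_{b'\succ_a b}x_{(a,b')}$, where $b'$ ranges over the neighbours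 of $a$ that $a$ ranks worse (respectively better) than $b$; define $\mathrm{vote}_b(a,x)$ symmetrically, and let $c_x(a,b)=1$ if $a\in U^*$ and $c_x(a,b)=\mathrm{vote}_a(b,x)+\mathrm{vote}_b(a,x)$ otherwise. Let $\mathcal C_{G^*}$ be the set of all $(x,\alpha)\in\mathbb R^{E^*}\times\mathbb R^{A\cup B}$ such that $$\sum_{u}\alpha_u=0,\qquad \alpha_a+\alpha_b\ge c_x(a,b)\ \ \forall (a,b)\in E^*,\qquad \alpha_u\ge-1\ \ \forall u,\qquad \alpha_u=0\ \ \forall u\in U^*,$$ $$\sum_{e\in\delta^*(u)}x_e=1\ \ \forall u\notin U^*,\qquad x_e=0\text{ for every non-dominant edge } e\text{ of }G^*,\qquad x_e\ge0\text{ for every dominant edge } e\text{ of }G^*.$$ Let $\mathcal F_{G^*}=\{(x,\alpha)\in\mathcal C_{G^*}:\ \alpha_a=-1\ \forall a\in U_A\setminus U^*\}$. **Theorem.** For every choice of the pairings: 1. $\mathcal F_{G^*}$ is a face of $\mathcal C_{G^*}$. 2. $\mathcal F_{G^*}$ is an integral polytope: it is the convex hull of the vectors $(I_T,\alpha)$ with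 $T$ an extra-dominant matching of $G^*$ and $\alpha$ an extra-dominant witness of $T$, and these vectors are exactly its extreme points. 3. $\mathcal F_{G^*}$ is an extension of the extra-dominant matching polytope of $G^*$: its image under the projection $(x,\alpha)\mapsto x$ is that polytope. 4. The extension has size $O(m+n)$: there is an absolute constant $K$ such that, for all instances and pairings, $\mathcal F_{G^*}$ lives in a space of dimension $|E^*|+n\le K(m+n)$ and is the solution set of a system of at most $K(m+n)$ linear inequalities and equations. -/

import Mathlib

open scoped Classical

/-- A marriage instance with sides `A` and `B`: a bipartite graph with edge set `E` in which every
vertex ranks its neighbours strictly (a smaller rank is better; ranks of non-neighbours carry no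
meaning). -/
structure MarriageInstance (A : Type*) (B : Type*) where
  E : Finset (A × B)
  rkA : A → B → ℕ
  rkB : B → A → ℕ
  rkA_inj : ∀ a b b', (a, b) ∈ E → (a, b') ∈ E → rkA a b = rkA a b' → b = b'
  rkB_inj : ∀ b a a', (a, b) ∈ E → (a', b) ∈ E → rkB b a = rkB b a' → a = a'

namespace MarriageInstance

variable {A : Type*} {B : Type*} (G : MarriageInstance A B)

/-- The type of edges, indexing the coordinates of `x`. -/
abbrev Edge : Type _ := {e : A × B // e ∈ G.E}

/-! ### Matchings, stability, popularity -/

def IsMatching (M : Finset (A × B)) : Prop :=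
  M ⊆ G.E ∧ ∀ e ∈ M, ∀ f ∈ M, e.1 = f.1 ∨ e.2 = f.2 → e = f

/-- The vertex `u` is matched in `M`. -/
def Matched (M : Finset (A × B)) : A ⊕ B → Prop
  | Sum.inl a => ∃ b, (a, b) ∈ M
  | Sum.inr b => ∃ a, (a, b) ∈ M

/-- `a` prefers `b` to its assignment in `M` (being unmatched is the worst assignment). -/
def VotesForA (M : Finset (A × B)) (a : A) (b : B) : Prop :=
  ∀ b', (a, b') ∈ M → G.rkA a b < G.rkA a b'

/-- `a` prefers its assignment in `M` to `b`. -/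
def VotesAgainstA (M : Finset (A × B)) (a : A) (b : B) : Prop :=
  ∃ b', (a, b') ∈ M ∧ G.rkA a b' < G.rkA a b

/-- `b` prefers `a` to its assignment in `M` (being unmatched is the worst assignment). -/
def VotesForB (M : Finset (A × B)) (b : B) (a : A) : Prop :=
  ∀ a', (a', b) ∈ M → G.rkB b a < G.rkB b a'

/-- `b` prefers its assignment in `M` to `a`. -/
def VotesAgainstB (M : Finset (A × B)) (b : B) (a : A) : Prop :=
  ∃ a', (a', b) ∈ M ∧ G.rkB b a' < G.rkB b a

/-- A stable matching: no edge is preferred by both of its endpoints to their assignments. -/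
def IsStable (M : Finset (A × B)) : Prop :=
  G.IsMatching M ∧ ∀ a b, (a, b) ∈ G.E → ¬ (G.VotesForA M a b ∧ G.VotesForB M b a)

/-- In an election between the matchings `M` and `N`, the vertex `u` votes for `M`. -/
def Prefers (M N : Finset (A × B)) : A ⊕ B → Prop
  | Sum.inl a => ∃ b, (a, b) ∈ M ∧ G.VotesForA N a b
  | Sum.inr b => ∃ a, (a, b) ∈ M ∧ G.VotesForB N b a

/-- `φ(M, N)`: the number of votes for `M` in the election between `M` and `N`. -/
noncomputable def phi [Fintype A] [Fintype B] (M N : Finset (A × B)) : ℕ :=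
  (Finset.univ.filter (fun u : A ⊕ B => G.Prefers M N u)).card

def IsPopular [Fintype A] [Fintype B] (M : Finset (A × B)) : Prop :=
  G.IsMatching M ∧ ∀ N, G.IsMatching N → G.phi N M ≤ G.phi M N

/-- A popular matching that is more popular than every strictly larger matching. -/
def IsDominant [Fintype A] [Fintype B] (M : Finset (A × B)) : Prop :=
  G.IsPopular M ∧ ∀ N, G.IsMatching N → M.card < N.card → G.phi N M < G.phi M N

def IsMaxSizePopular [Fintype A] [Fintype B] (M : Finset (A × B)) : Prop :=
  G.IsPopular M ∧ ∀ N, G.IsPopular N → N.card ≤ M.card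

/-- A stable vertex: matched in some stable matching. -/
def StableVertex (u : A ⊕ B) : Prop := ∃ M, G.IsStable M ∧ Matched M u

/-- A popular vertex: matched in some popular matching of maximum size. -/
def PopularVertex [Fintype A] [Fintype B] (u : A ⊕ B) : Prop :=
  ∃ M, G.IsMaxSizePopular M ∧ Matched M u

/-- A popular edge: contained in some popular matching. -/
def PopularEdge [Fintype A] [Fintype B] (e : A × B) : Prop := ∃ M, G.IsPopular M ∧ e ∈ M

/-- A dominant edge: contained in some dominant matching. -/
def DominantEdge [Fintype A] [Fintype B] (e : A × B) : Prop := ∃ M, G.IsDominant M ∧ e ∈ M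

/-! ### Witnesses -/

/-- The edge weight `wt_M(a, b)`. -/
noncomputable def wtM (M : Finset (A × B)) (a : A) (b : B) : ℝ :=
  if (a, b) ∈ M then 0
  else if G.VotesForA M a b ∧ G.VotesForB M b a then 2
  else if G.VotesAgainstA M a b ∧ G.VotesAgainstB M b a then -2
  else 0

/-- The self-loop weight `wt_M(u, u)`. -/
noncomputable def wtLoop (M : Finset (A × B)) (u : A ⊕ B) : ℝ :=
  if Matched M u then -1 else 0

/-- `α ∈ {0, ±1}^n` is a witness of the matching `M`. -/
def IsWitness [Fintype A] [Fintype B] (M : Finset (A × B)) (α : A ⊕ B → ℝ) : Prop :=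
  (∀ u, α u = 0 ∨ α u = 1 ∨ α u = -1) ∧
  ∑ u, α u = 0 ∧
  (∀ a b, (a, b) ∈ G.E → G.wtM M a b ≤ α (Sum.inl a) + α (Sum.inr b)) ∧
  ∀ u, wtLoop M u ≤ α u

/-! ### The popular subgraph and the augmented instance -/

/-- The popular subgraph, on the vertex set `A ⊕ B`. -/
def popularSubgraph [Fintype A] [Fintype B] : SimpleGraph (A ⊕ B) :=
  SimpleGraph.fromRel fun u v =>
    ∃ a b, u = Sum.inl a ∧ v = Sum.inr b ∧ (a, b) ∈ G.E ∧ G.PopularEdge (a, b)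

/-- The component of `u` in the popular subgraph has at least two vertices. -/
def InNontrivialComponent [Fintype A] [Fintype B] (u : A ⊕ B) : Prop :=
  ∃ v, v ≠ u ∧ G.popularSubgraph.Reachable u v

/-- A choice of the pairings used in the augmentation. In every non-trivial component of the
popular subgraph the unstable vertices of the `A`-side are paired bijectively with the unstable
vertices of the `B`-side; the vertices of the `B`-side forming singleton components are paired with
distinct vertices of the `A`-side forming singleton components. -/
structure Pairing [Fintype A] [Fintype B] where
  S : Finset (A × B)
  disjoint : ∀ e ∈ S, ∀ f ∈ S, e.1 = f.1 ∨ e.2 = f.2 → e = f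
  pairs : ∀ a b, (a, b) ∈ S →
    (¬ G.StableVertex (Sum.inl a) ∧ ¬ G.StableVertex (Sum.inr b) ∧
      G.InNontrivialComponent (Sum.inl a) ∧
      G.popularSubgraph.Reachable (Sum.inl a) (Sum.inr b)) ∨
    (¬ G.InNontrivialComponent (Sum.inl a) ∧ ¬ G.InNontrivialComponent (Sum.inr b))
  coversA : ∀ a, ¬ G.StableVertex (Sum.inl a) → G.InNontrivialComponent (Sum.inl a) →
    ∃ b, (a, b) ∈ S
  coversB : ∀ b, ¬ G.StableVertex (Sum.inr b) → G.InNontrivialComponent (Sum.inr b) →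
    ∃ a, (a, b) ∈ S
  coversTrivial : ∀ b, ¬ G.InNontrivialComponent (Sum.inr b) → ∃ a, (a, b) ∈ S

variable {G} in
/-- The augmented instance `G*`: the pairs of the pairing are added as edges, and a new neighbour
is the least preferred one. -/
noncomputable def Pairing.augment [Fintype A] [Fintype B] (P : G.Pairing) :
    MarriageInstance A B where
  E := G.E ∪ P.S
  rkA a b := if (a, b) ∈ G.E then G.rkA a b else (∑ b', G.rkA a b') + 1
  rkB b a := if (a, b) ∈ G.E then G.rkB b a else (∑ a', G.rkB b a') + 1
  rkA_inj := by
    intro a b b' h h' heq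
    have hle : ∀ c, G.rkA a c ≤ ∑ b', G.rkA a b' := fun c =>
      Finset.single_le_sum (f := fun c => G.rkA a c) (fun _ _ => Nat.zero_le _)
        (Finset.mem_univ c)
    by_cases h1 : (a, b) ∈ G.E <;> by_cases h2 : (a, b') ∈ G.E
    · simp only [h1, h2, if_true] at heq
      exact G.rkA_inj a b b' h1 h2 heq
    · simp only [h1, h2, if_true, if_false] at heq
      have := hle b
      omega
    · simp only [h1, h2, if_true, if_false] at heq
      have := hle b'
      omega
    · have e1 := (Finset.mem_union.1 h).resolve_left h1
      have e2 := (Finset.mem_union.1 h').resolve_left h2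
      exact congrArg Prod.snd (P.disjoint _ e1 _ e2 (Or.inl rfl))
  rkB_inj := by
    intro b a a' h h' heq
    have hle : ∀ c, G.rkB b c ≤ ∑ a', G.rkB b a' := fun c =>
      Finset.single_le_sum (f := fun c => G.rkB b c) (fun _ _ => Nat.zero_le _)
        (Finset.mem_univ c)
    by_cases h1 : (a, b) ∈ G.E <;> by_cases h2 : (a', b) ∈ G.E
    · simp only [h1, h2, if_true] at heq
      exact G.rkB_inj b a a' h1 h2 heq
    · simp only [h1, h2, if_true, if_false] at heq
      have := hle a
      omega
    · simp only [h1, h2, if_true, if_false] at heq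
      have := hle a'
      omega
    · have e1 := (Finset.mem_union.1 h).resolve_left h1
      have e2 := (Finset.mem_union.1 h').resolve_left h2
      exact congrArg Prod.fst (P.disjoint _ e1 _ e2 (Or.inr rfl))

variable {G} in
/-- The vertices of `U_A \ U*`: unstable in `G` and stable in the augmented instance. -/
def Pairing.NewlyStable [Fintype A] [Fintype B] (P : G.Pairing) (a : A) : Prop :=
  ¬ G.StableVertex (Sum.inl a) ∧ P.augment.StableVertex (Sum.inl a)

/-! ### The polytopes -/

/-- The edges incident to a vertex. -/
noncomputable def delta : A ⊕ B → Finset G.Edge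
  | Sum.inl a => Finset.univ.filter fun e => e.1.1 = a
  | Sum.inr b => Finset.univ.filter fun e => e.1.2 = b

/-- `vote_a(b, x)`: the weight of the assignments of `a` worse than `b`, including the self-loop
weight `1 - x(δ(a))`, minus the weight of those better than `b`. -/
noncomputable def voteA (x : G.Edge → ℝ) (a : A) (b : B) : ℝ :=
  ((1 - ∑ e ∈ G.delta (Sum.inl a), x e) +
      ∑ e ∈ (G.delta (Sum.inl a)).filter (fun e => G.rkA a b < G.rkA a e.1.2), x e) -
    ∑ e ∈ (G.delta (Sum.inl a)).filter (fun e => G.rkA a e.1.2 < G.rkA a b), x e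

noncomputable def voteB (x : G.Edge → ℝ) (b : B) (a : A) : ℝ :=
  ((1 - ∑ e ∈ G.delta (Sum.inr b), x e) +
      ∑ e ∈ (G.delta (Sum.inr b)).filter (fun e => G.rkB b a < G.rkB b e.1.1), x e) -
    ∑ e ∈ (G.delta (Sum.inr b)).filter (fun e => G.rkB b e.1.1 < G.rkB b a), x e

/-- `wt_x(a, b)`. -/
noncomputable def wt (x : G.Edge → ℝ) (a : A) (b : B) : ℝ := G.voteA x a b + G.voteB x b a

/-- `c_x(a, b)`: equal to `1` if `a` is unstable, and to `wt_x(a, b)` otherwise. -/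
noncomputable def cWt (x : G.Edge → ℝ) (a : A) (b : B) : ℝ :=
  if G.StableVertex (Sum.inl a) then G.wt x a b else 1

/-- The polytope `C` of an instance, in the variables `(x, α)`. -/
def polytopeC [Fintype A] [Fintype B] : Set ((G.Edge → ℝ) × (A ⊕ B → ℝ)) :=
  {p | ∑ u, p.2 u = 0 ∧
    (∀ a b, (a, b) ∈ G.E → G.cWt p.1 a b ≤ p.2 (Sum.inl a) + p.2 (Sum.inr b)) ∧
    (∀ u, -1 ≤ p.2 u) ∧
    (∀ u, ¬ G.StableVertex u → p.2 u = 0) ∧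
    (∀ u, G.StableVertex u → ∑ e ∈ G.delta u, p.1 e = 1) ∧
    (∀ e : G.Edge, ¬ G.DominantEdge e.1 → p.1 e = 0) ∧
    (∀ e : G.Edge, G.DominantEdge e.1 → 0 ≤ p.1 e)}

/-- The incidence vector of a matching. -/
noncomputable def incidence (M : Finset (A × B)) : G.Edge → ℝ :=
  fun e => if e.1 ∈ M then 1 else 0

variable {G} in
/-- The polytope `F`, in the variables `(x, α)`: the constraints of `C` for the augmented instance
together with `α_a = -1` for `a ∈ U_A \ U*`. -/
def Pairing.polytopeF [Fintype A] [Fintype B] (P : G.Pairing) :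
    Set ((P.augment.Edge → ℝ) × (A ⊕ B → ℝ)) :=
  {p | p ∈ P.augment.polytopeC ∧ ∀ a, P.NewlyStable a → p.2 (Sum.inl a) = -1}

variable {G} in
/-- `α` is an extra-dominant witness of `T` in the augmented instance. -/
def Pairing.IsExtraDominantWitness [Fintype A] [Fintype B] (P : G.Pairing)
    (T : Finset (A × B)) (α : A ⊕ B → ℝ) : Prop :=
  P.augment.IsWitness T α ∧
  (∀ v, P.augment.PopularVertex v → α v = 1 ∨ α v = -1) ∧
  ∀ a, P.NewlyStable a → α (Sum.inl a) = -1

variable {G} in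
/-- `T` is an extra-dominant matching of the augmented instance. -/
def Pairing.IsExtraDominant [Fintype A] [Fintype B] (P : G.Pairing)
    (T : Finset (A × B)) : Prop :=
  P.augment.IsPopular T ∧ ∃ α, P.IsExtraDominantWitness T α

variable {G} in
/-- The extra-dominant matching polytope of the augmented instance. -/
def Pairing.extraDominantPolytope [Fintype A] [Fintype B] (P : G.Pairing) :
    Set (P.augment.Edge → ℝ) :=
  convexHull ℝ {x | ∃ T, P.IsExtraDominant T ∧ x = P.augment.incidence T}

variable {G} in
/-- The vectors `(I_T, α)` with `T` extra-dominant and `α` an extra-dominant witness of `T`. -/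
def Pairing.extraDominantPairs [Fintype A] [Fintype B] (P : G.Pairing) :
    Set ((P.augment.Edge → ℝ) × (A ⊕ B → ℝ)) :=
  {p | ∃ T, P.IsExtraDominant T ∧ P.IsExtraDominantWitness T p.2 ∧
    p.1 = P.augment.incidence T}

end MarriageInstance

/-- `Q` is the solution set of a system of at most `N` linear inequalities and equations. -/
def HasLinearDescription {X : Type*} [AddCommGroup X] [Module ℝ X] (Q : Set X) (N : ℕ) : Prop :=
  ∃ (k l : ℕ) (f : Fin k → X →ₗ[ℝ] ℝ) (c : Fin k → ℝ) (g : Fin l → X →ₗ[ℝ] ℝ) (d : Fin l → ℝ),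
    k + l ≤ N ∧ Q = {p | (∀ i, c i ≤ f i p) ∧ ∀ j, g j p = d j}

/-! The pairing makes every vertex of B stable in G*: a stable matching of G stays stable when all
pairs are added (`Pairing.isStable_union`, `Pairing.stableVertex_inr`). Popular matchings cover all
stable vertices, so in such an instance they all have |B| edges and match exactly the stable
vertices. Hence every popular matching is dominant and popular vertices are the stable ones.
Witnesses certify popularity by weak LP duality, and an extra-dominant matching with an
extra-dominant witness is a point of F.

The converse is a rounding argument. Let (x, α) lie in C. At each vertex the votes weighted by x
cancel, and the α sum to 0, so the x-weighted total slack of the edge constraints is 0 and every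
edge with x_e > 0 is tight (`polytopeC_slack`). With q_u = (1 + α_u)/2, which lies in [0, 1],
tightness of e = (a, b) says that the weight a prefers to e, plus x_e, plus the weight b prefers to
e, plus q_a + q_b, equals 2. Each stable vertex lays out its edges from best to worst as consecutive
cells of lengths x_e filling a unit interval. For t in [0, 1), let a choose the cell at frac(t -
q_a) and b the cell at 1 - frac(t + q_b). The equation makes the two choices agree
(`cell_iff_cell`), so the chosen edges form a matching. Rounding α to ±1 at stable vertices,
according to t < q_a and t < 1 - q_b, gives a witness of it (`isWitness_roundWitness`). Averaging
over t recovers (x, α) (`integral_roundPair`), so a point of F is in the convex hull of finitely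
many extra-dominant pairs.

These pairs are corners of a box containing F, hence extreme. F is exposed by minus the sum of the
α_a that it fixes at their lower bound -1. The size bound counts constraints, using |E*| ≤ m + n. -/

namespace MarriageInstance

variable {A : Type*} {B : Type*} (G : MarriageInstance A B)

/-! ### Existence of stable matchings -/

/-- Stable matchings exist; the proof takes a fixed point of a monotone map on sets of edges. -/
theorem exists_isStable : ∃ M, G.IsStable M := by
  let DA : Set (A × B) → Set (A × B) := fun X =>
    {e | ∃ b', (e.1, b') ∈ X ∧ G.rkA e.1 b' < G.rkA e.1 e.2}
  let DB : Set (A × B) → Set (A × B) := fun X =>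
    {e | ∃ a', (a', e.2) ∈ X ∧ G.rkB e.2 a' < G.rkB e.2 e.1}
  have hDA : Monotone DA := fun X Y h e ⟨b', h1, h2⟩ => ⟨b', h h1, h2⟩
  have hDB : Monotone DB := fun X Y h e ⟨b', h1, h2⟩ => ⟨b', h h1, h2⟩
  -- Y is to consist of the edges not beaten at their A-end by an edge of X, and X of those not
  -- beaten at their B-end by an edge of Y. Each condition is antitone, so the composite is
  -- monotone; at a fixed point X ∩ Y is a stable matching.
  let F : Set (A × B) →o Set (A × B) :=
    ⟨fun X => ↑G.E \ DB (↑G.E \ DA X), fun X Y h =>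
      Set.sdiff_subset_sdiff_right (hDB (Set.sdiff_subset_sdiff_right (hDA h)))⟩
  obtain ⟨X, hX⟩ : ∃ X, F X = X := ⟨F.lfp, F.map_lfp⟩
  obtain ⟨Y, hY⟩ : ∃ Y : Set (A × B), Y = ↑G.E \ DA X := ⟨_, rfl⟩
  have hX' : X = ↑G.E \ DB Y := by rw [hY]; exact hX.symm
  have memX : ∀ e, e ∈ X ↔ e ∈ G.E ∧ e ∉ DB Y := fun e => by
    conv_lhs => rw [hX']
    rfl
  have memY : ∀ e, e ∈ Y ↔ e ∈ G.E ∧ e ∉ DA X := fun e => by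
    conv_lhs => rw [hY]
    rfl
  -- The best edge of X that beats (a, b) at a lies in Y as well, since no edge of X beats it there.
  have bestA : ∀ a b, (a, b) ∈ DA X →
      ∃ b', (a, b') ∈ X ∧ (a, b') ∈ Y ∧ G.rkA a b' < G.rkA a b := by
    rintro a b ⟨c, hc, hlt⟩
    let T : Set B := {c | (a, c) ∈ X ∧ G.rkA a c < G.rkA a b}
    obtain ⟨d, hd, hmin⟩ :=
      WellFounded.has_min (measure (G.rkA a)).wf T ⟨c, hc, hlt⟩
    refine ⟨d, hd.1, (memY _).2 ⟨((memX _).1 hd.1).1, ?_⟩, hd.2⟩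
    rintro ⟨c', hc', hlt'⟩
    exact hmin c' ⟨hc', hlt'.trans hd.2⟩ hlt'
  have bestB : ∀ a b, (a, b) ∈ DB Y →
      ∃ a', (a', b) ∈ X ∧ (a', b) ∈ Y ∧ G.rkB b a' < G.rkB b a := by
    rintro a b ⟨c, hc, hlt⟩
    let T : Set A := {c | (c, b) ∈ Y ∧ G.rkB b c < G.rkB b a}
    obtain ⟨d, hd, hmin⟩ :=
      WellFounded.has_min (measure (G.rkB b)).wf T ⟨c, hc, hlt⟩
    refine ⟨d, (memX _).2 ⟨((memY _).1 hd.1).1, ?_⟩, hd.1, hd.2⟩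
    rintro ⟨c', hc', hlt'⟩
    exact hmin c' ⟨hc', hlt'.trans hd.2⟩ hlt'
  refine ⟨G.E.filter (fun e => e ∈ X ∧ e ∈ Y), ⟨Finset.filter_subset _ _, ?_⟩, ?_⟩
  · rintro ⟨a, b⟩ he ⟨a', b'⟩ hf hef
    simp only [Finset.mem_filter] at he hf hef
    rcases hef with rfl | rfl
    · rcases lt_trichotomy (G.rkA a b) (G.rkA a b') with h | h | h
      · exact absurd ⟨b, he.2.1, h⟩ ((memY _).1 hf.2.2).2
      · rw [G.rkA_inj a b b' he.1 hf.1 h]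
      · exact absurd ⟨b', hf.2.1, h⟩ ((memY _).1 he.2.2).2
    · rcases lt_trichotomy (G.rkB b a) (G.rkB b a') with h | h | h
      · exact absurd ⟨a, he.2.2, h⟩ ((memX _).1 hf.2.1).2
      · rw [G.rkB_inj b a a' he.1 hf.1 h]
      · exact absurd ⟨a', hf.2.2, h⟩ ((memX _).1 he.2.1).2
  · rintro a b hab ⟨hA, hB⟩
    have hxy : (a, b) ∈ X ∧ (a, b) ∈ Y → False := fun h =>
      lt_irrefl _ (hA b (Finset.mem_filter.2 ⟨hab, h⟩))
    by_cases hx : (a, b) ∈ X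
    · have : (a, b) ∈ DA X := by
        by_contra h
        exact hxy ⟨hx, (memY _).2 ⟨hab, h⟩⟩
      obtain ⟨b', h1, h2, h3⟩ := bestA a b this
      exact lt_asymm h3 (hA b' (Finset.mem_filter.2 ⟨((memX _).1 h1).1, h1, h2⟩))
    · have : (a, b) ∈ DB Y := by
        by_contra h
        exact hx ((memX _).2 ⟨hab, h⟩)
      obtain ⟨a', h1, h2, h3⟩ := bestB a b this
      exact lt_asymm h3 (hB a' (Finset.mem_filter.2 ⟨((memX _).1 h1).1, h1, h2⟩))

/-! ### Votes -/

variable {G}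

theorem IsMatching.eq_right {M : Finset (A × B)} (hM : G.IsMatching M) {a : A} {b b' : B}
    (h : (a, b) ∈ M) (h' : (a, b') ∈ M) : b = b' :=
  congrArg Prod.snd (hM.2 _ h _ h' (Or.inl rfl))

theorem IsMatching.eq_left {M : Finset (A × B)} (hM : G.IsMatching M) {a a' : A} {b : B}
    (h : (a, b) ∈ M) (h' : (a', b) ∈ M) : a = a' :=
  congrArg Prod.fst (hM.2 _ h _ h' (Or.inr rfl))

variable (G) in
/-- The vote of `a` between `b` and its assignment in `M`. -/
noncomputable def signA (M : Finset (A × B)) (a : A) (b : B) : ℝ :=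
  (if G.VotesForA M a b then 1 else 0) - (if G.VotesAgainstA M a b then 1 else 0)

variable (G) in
/-- The vote of `b` between `a` and its assignment in `M`. -/
noncomputable def signB (M : Finset (A × B)) (b : B) (a : A) : ℝ :=
  (if G.VotesForB M b a then 1 else 0) - (if G.VotesAgainstB M b a then 1 else 0)

theorem VotesForA.not_against {M : Finset (A × B)} {a : A} {b : B} (h : G.VotesForA M a b) :
    ¬ G.VotesAgainstA M a b := fun ⟨b', h1, h2⟩ => lt_asymm h2 (h b' h1)

theorem VotesForB.not_against {M : Finset (A × B)} {a : A} {b : B} (h : G.VotesForB M b a) :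
    ¬ G.VotesAgainstB M b a := fun ⟨b', h1, h2⟩ => lt_asymm h2 (h b' h1)

theorem IsMatching.votesForA_or {M : Finset (A × B)} (hM : G.IsMatching M) {a : A} {b : B}
    (hE : (a, b) ∈ G.E) (h : (a, b) ∉ M) : G.VotesForA M a b ∨ G.VotesAgainstA M a b := by
  by_contra! hc
  obtain ⟨h1, h2⟩ := hc
  refine h1 fun b' hb' => ?_
  rcases lt_trichotomy (G.rkA a b) (G.rkA a b') with h' | h' | h'
  · exact h'
  · exact absurd (G.rkA_inj a b b' hE (hM.1 hb') h' ▸ hb') h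
  · exact absurd ⟨b', hb', h'⟩ h2

theorem IsMatching.votesForB_or {M : Finset (A × B)} (hM : G.IsMatching M) {a : A} {b : B}
    (hE : (a, b) ∈ G.E) (h : (a, b) ∉ M) : G.VotesForB M b a ∨ G.VotesAgainstB M b a := by
  by_contra! hc
  obtain ⟨h1, h2⟩ := hc
  refine h1 fun a' ha' => ?_
  rcases lt_trichotomy (G.rkB b a) (G.rkB b a') with h' | h' | h'
  · exact h'
  · exact absurd (G.rkB_inj b a a' hE (hM.1 ha') h' ▸ ha') h
  · exact absurd ⟨a', ha', h'⟩ h2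

theorem IsMatching.not_votes_of_mem {M : Finset (A × B)} (hM : G.IsMatching M) {a : A} {b : B}
    (h : (a, b) ∈ M) : ¬ G.VotesForA M a b ∧ ¬ G.VotesAgainstA M a b ∧
      ¬ G.VotesForB M b a ∧ ¬ G.VotesAgainstB M b a := by
  refine ⟨fun h' => lt_irrefl _ (h' b h), ?_, fun h' => lt_irrefl _ (h' a h), ?_⟩
  · rintro ⟨b', h1, h2⟩
    rw [hM.eq_right h1 h] at h2
    exact lt_irrefl _ h2
  · rintro ⟨b', h1, h2⟩
    rw [hM.eq_left h1 h] at h2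
    exact lt_irrefl _ h2

theorem IsMatching.wtM_eq {M : Finset (A × B)} (hM : G.IsMatching M) {a : A} {b : B}
    (hE : (a, b) ∈ G.E) : G.wtM M a b = G.signA M a b + G.signB M b a := by
  unfold wtM signA signB
  by_cases h : (a, b) ∈ M
  · obtain ⟨h1, h2, h3, h4⟩ := hM.not_votes_of_mem h
    simp [h, h1, h2, h3, h4]
  · rcases hM.votesForA_or hE h with hA | hA <;> rcases hM.votesForB_or hE h with hB | hB
    · simp [h, hA, hB, hA.not_against, hB.not_against]; norm_num
    · have hB' : ¬ G.VotesForB M b a := fun h => h.not_against hB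
      simp [h, hA, hB, hA.not_against, hB']
    · have hA' : ¬ G.VotesForA M a b := fun h => h.not_against hA
      simp [h, hA, hB, hB.not_against, hA']
    · have hA' : ¬ G.VotesForA M a b := fun h => h.not_against hA
      have hB' : ¬ G.VotesForB M b a := fun h => h.not_against hB
      simp [h, hA, hB, hB', hA']; norm_num

theorem wtM_le_two (M : Finset (A × B)) (a : A) (b : B) : G.wtM M a b ≤ 2 := by
  unfold wtM; split_ifs <;> norm_num

theorem wtM_nonpos {M : Finset (A × B)} {a : A} {b : B}
    (h : ¬ (G.VotesForA M a b ∧ G.VotesForB M b a)) : G.wtM M a b ≤ 0 := by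
  unfold wtM; rw [if_neg h]; split_ifs <;> norm_num

theorem wtM_nonneg {M : Finset (A × B)} {a : A} {b : B}
    (h : ¬ (G.VotesAgainstA M a b ∧ G.VotesAgainstB M b a)) : 0 ≤ G.wtM M a b := by
  unfold wtM; rw [if_neg h]; split_ifs <;> norm_num

theorem IsMatching.card_eq [Fintype B] {M : Finset (A × B)} (hM : G.IsMatching M)
    (h : ∀ b, Matched M (Sum.inr b)) : M.card = Fintype.card B := by
  rw [← Finset.card_image_of_injOn (f := Prod.snd)
    (fun e he f hf h => hM.2 e he f hf (Or.inr h)), ← Finset.card_univ]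
  congr 1
  ext b
  simpa [Matched] using h b

theorem IsMatching.card_le [Fintype B] {M : Finset (A × B)} (hM : G.IsMatching M) :
    M.card ≤ Fintype.card B := by
  rw [← Finset.card_image_of_injOn (f := Prod.snd)
    (fun e he f hf h => hM.2 e he f hf (Or.inr h))]
  exact Finset.card_le_univ _

/-! ### Elections as sums of edge weights, and witnesses as certificates of popularity -/

variable [Fintype A] [Fintype B]

/-- A sum over the vertices, grouped along a matching. -/
theorem IsMatching.sum_eq {M : Finset (A × B)} (hM : G.IsMatching M) (f : A ⊕ B → ℝ) :
    ∑ u, f u = ∑ e ∈ M, (f (Sum.inl e.1) + f (Sum.inr e.2)) +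
      ∑ u with ¬ Matched M u, f u := by
  have hA : ∑ e ∈ M, f (Sum.inl e.1) = ∑ a, if Matched M (Sum.inl a) then f (Sum.inl a) else 0 := by
    rw [← Finset.sum_filter, ← Finset.sum_image (f := fun a => f (Sum.inl a)) (g := Prod.fst)
      (fun e he e' he' h => hM.2 e he e' he' (Or.inl h))]
    congr 1
    ext a
    rw [Finset.mem_filter]
    simp [Matched]
  have hB : ∑ e ∈ M, f (Sum.inr e.2) = ∑ b, if Matched M (Sum.inr b) then f (Sum.inr b) else 0 := by
    rw [← Finset.sum_filter, ← Finset.sum_image (f := fun b => f (Sum.inr b)) (g := Prod.snd)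
      (fun e he e' he' h => hM.2 e he e' he' (Or.inr h))]
    congr 1
    ext a
    rw [Finset.mem_filter]
    simp [Matched]
  rw [Finset.sum_add_distrib, hA, hB, ← Fintype.sum_sum_type
    (fun u => if Matched M u then f u else 0), ← Finset.sum_filter,
    Finset.sum_filter_add_sum_filter_not]

/-- Each edge of N collects the votes of its two ends, which add up to its weight under M. A vertex
missed by N votes exactly when M matches it, and then for M. -/
theorem phi_sub_phi {M N : Finset (A × B)} (hM : G.IsMatching M) (hN : G.IsMatching N) :
    (G.phi N M : ℝ) - G.phi M N =
      ∑ e ∈ N, G.wtM M e.1 e.2 + ∑ u with ¬ Matched N u, wtLoop M u := by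
  have hphi : ∀ M N, (G.phi M N : ℝ) = ∑ u, if G.Prefers M N u then 1 else 0 := fun M N => by
    simp [phi, Finset.sum_boole]
  rw [hphi, hphi, ← Finset.sum_sub_distrib, hN.sum_eq]
  congr 1
  · refine Finset.sum_congr rfl fun e he => ?_
    obtain ⟨a, b⟩ := e
    rw [hM.wtM_eq (hN.1 he)]
    have h1 : G.Prefers N M (Sum.inl a) ↔ G.VotesForA M a b :=
      ⟨fun ⟨b', h, h'⟩ => hN.eq_right h he ▸ h', fun h => ⟨b, he, h⟩⟩
    have h2 : G.Prefers M N (Sum.inl a) ↔ G.VotesAgainstA M a b :=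
      ⟨fun ⟨b', h, h'⟩ => ⟨b', h, h' b he⟩, fun ⟨b', h, h'⟩ => ⟨b', h, fun c hc =>
        hN.eq_right he hc ▸ h'⟩⟩
    have h3 : G.Prefers N M (Sum.inr b) ↔ G.VotesForB M b a :=
      ⟨fun ⟨b', h, h'⟩ => hN.eq_left h he ▸ h', fun h => ⟨a, he, h⟩⟩
    have h4 : G.Prefers M N (Sum.inr b) ↔ G.VotesAgainstB M b a :=
      ⟨fun ⟨b', h, h'⟩ => ⟨b', h, h' a he⟩, fun ⟨b', h, h'⟩ => ⟨b', h, fun c hc =>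
        hN.eq_left he hc ▸ h'⟩⟩
    simp only [h1, h2, h3, h4]
    rfl
  · refine Finset.sum_congr rfl fun u hu => ?_
    have hu : ¬ Matched N u := (Finset.mem_filter.1 hu).2
    have h1 : ¬ G.Prefers N M u := fun h => hu <| by
      cases u with
      | inl a => exact ⟨h.choose, h.choose_spec.1⟩
      | inr b => exact ⟨h.choose, h.choose_spec.1⟩
    have h2 : G.Prefers M N u ↔ Matched M u := by
      cases u with
      | inl a => exact ⟨fun ⟨b, h, _⟩ => ⟨b, h⟩, fun ⟨b, h⟩ =>
          ⟨b, h, fun c hc => absurd ⟨c, hc⟩ hu⟩⟩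
      | inr b => exact ⟨fun ⟨b, h, _⟩ => ⟨b, h⟩, fun ⟨b, h⟩ =>
          ⟨b, h, fun c hc => absurd ⟨c, hc⟩ hu⟩⟩
    rw [if_neg h1, wtLoop]
    simp only [h2]
    split_ifs <;> norm_num

/-- Weak duality: grouping the sum of α along N and the vertices it misses bounds the vote
difference by that sum, which is 0. -/
theorem IsWitness.isPopular {M : Finset (A × B)} (hM : G.IsMatching M) {α : A ⊕ B → ℝ}
    (h : G.IsWitness M α) : G.IsPopular M := by
  refine ⟨hM, fun N hN => ?_⟩
  have h1 := phi_sub_phi hM hN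
  have h2 := hN.sum_eq α
  rw [h.2.1] at h2
  have h3 : ∑ e ∈ N, G.wtM M e.1 e.2 ≤ ∑ e ∈ N, (α (Sum.inl e.1) + α (Sum.inr e.2)) :=
    Finset.sum_le_sum fun e he => h.2.2.1 _ _ (hN.1 he)
  have h4 : ∑ u with ¬ Matched N u, wtLoop M u ≤ ∑ u with ¬ Matched N u, α u :=
    Finset.sum_le_sum fun u _ => h.2.2.2 u
  have : (G.phi N M : ℝ) ≤ G.phi M N := by linarith
  exact_mod_cast this

theorem IsStable.isPopular {M : Finset (A × B)} (h : G.IsStable M) : G.IsPopular M := by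
  refine IsWitness.isPopular (α := 0) h.1 ⟨by simp, by simp, fun a b hab => ?_, fun u => ?_⟩
  · simpa using wtM_nonpos (h.2 a b hab)
  · unfold wtLoop; split_ifs <;> simp

/-- Popular matchings match every stable vertex. -/
theorem IsPopular.matched_of_stableVertex {N : Finset (A × B)} (hN : G.IsPopular N) {u : A ⊕ B}
    (hu : G.StableVertex u) : Matched N u := by
  obtain ⟨M, hM, hMu⟩ := hu
  by_contra hNu
  have h1 := phi_sub_phi hM.1 hN.1
  have h2 : ∑ e ∈ N, G.wtM M e.1 e.2 ≤ 0 :=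
    Finset.sum_nonpos fun e he => wtM_nonpos (hM.2 _ _ (hN.1.1 he))
  -- No loop weight is positive and that of u is -1, so M would strictly beat N.
  have h3 : ∑ u with ¬ Matched N u, wtLoop M u ≤ wtLoop M u := by
    rw [← neg_le_neg_iff, ← Finset.sum_neg_distrib]
    refine Finset.single_le_sum (f := fun v => -wtLoop M v) (fun v _ => ?_) ?_
    · unfold wtLoop; split_ifs <;> simp
    · exact Finset.mem_filter.2 ⟨Finset.mem_univ _, hNu⟩
  have h4 : wtLoop M u = -1 := if_pos hMu
  have h5 : (G.phi M N : ℝ) ≤ G.phi N M := by exact_mod_cast hN.2 M hM.1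
  linarith

/-! ### The augmented instance -/

/-- Paired vertices are unstable or isolated in the popular subgraph, whereas an edge of M is
popular and joins two stable vertices; so the pairs avoid M. An edge of G blocking the union would
already block M, since ranks within G are unchanged. -/
theorem Pairing.isStable_union {P : G.Pairing} {M : Finset (A × B)} (hM : G.IsStable M) :
    P.augment.IsStable (M ∪ P.S) := by
  have hMatched : ∀ a b, (a, b) ∈ M →
      G.StableVertex (Sum.inl a) ∧ G.StableVertex (Sum.inr b) ∧
      G.InNontrivialComponent (Sum.inl a) ∧ G.InNontrivialComponent (Sum.inr b) := by
    intro a b hab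
    have hadj : G.popularSubgraph.Adj (Sum.inl a) (Sum.inr b) := by
      unfold popularSubgraph
      rw [SimpleGraph.fromRel_adj]
      exact ⟨by simp, Or.inl ⟨a, b, rfl, rfl, hM.1.1 hab, M, hM.isPopular, hab⟩⟩
    exact ⟨⟨M, hM, b, hab⟩, ⟨M, hM, a, hab⟩, ⟨_, by simp, hadj.reachable⟩,
      ⟨_, by simp, hadj.symm.reachable⟩⟩
  have hdisj : ∀ e ∈ M, ∀ f ∈ P.S, ¬ (e.1 = f.1 ∨ e.2 = f.2) := by
    rintro ⟨a, b⟩ he ⟨a', b'⟩ hf h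
    obtain ⟨h1, h2, h3, h4⟩ := hMatched a b he
    simp only at h
    rcases h with rfl | rfl <;> rcases P.pairs _ _ hf with h5 | h5
    · exact h5.1 h1
    · exact h5.1 h3
    · exact h5.2.1 h2
    · exact h5.2 h4
  have hmatch : P.augment.IsMatching (M ∪ P.S) := by
    refine ⟨Finset.union_subset_union_left hM.1.1, fun e he f hf h => ?_⟩
    rcases Finset.mem_union.1 he with he | he <;> rcases Finset.mem_union.1 hf with hf | hf
    · exact hM.1.2 e he f hf h
    · exact absurd h (hdisj e he f hf)
    · exact absurd (h.imp Eq.symm Eq.symm) (hdisj f hf e he)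
    · exact P.disjoint e he f hf h
  refine ⟨hmatch, fun a b hab ⟨hA, hB⟩ => ?_⟩
  rcases Finset.mem_union.1 hab with hE | hS
  · have hA' : ∀ b', (a, b') ∈ M → G.rkA a b < G.rkA a b' := fun b' hb' => by
      have := hA b' (Finset.mem_union_left _ hb')
      simpa only [Pairing.augment, hE, hM.1.1 hb', if_true] using this
    have hB' : ∀ a', (a', b) ∈ M → G.rkB b a < G.rkB b a' := fun a' ha' => by
      have := hB a' (Finset.mem_union_left _ ha')
      simpa only [Pairing.augment, hE, hM.1.1 ha', if_true] using this
    exact hM.2 a b hE ⟨hA', hB'⟩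
  · exact (hmatch.not_votes_of_mem (Finset.mem_union_right _ hS)).1 hA

/-- This is the purpose of the augmentation: vertices of B stable in G are covered by the stable
matching of G, all others by their pair. The polytope argument applies to any instance with this
property. -/
theorem Pairing.stableVertex_inr (P : G.Pairing) (b : B) :
    P.augment.StableVertex (Sum.inr b) := by
  obtain ⟨M, hM⟩ := G.exists_isStable
  by_cases hb : G.StableVertex (Sum.inr b)
  · obtain ⟨a, ha⟩ := hM.isPopular.matched_of_stableVertex hb
    exact ⟨_, isStable_union hM, a, Finset.mem_union_left _ ha⟩
  · obtain ⟨a, ha⟩ : ∃ a, (a, b) ∈ P.S := by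
      by_cases h : G.InNontrivialComponent (Sum.inr b)
      · exact P.coversB b hb h
      · exact P.coversTrivial b h
    exact ⟨_, isStable_union hM, a, Finset.mem_union_right _ ha⟩

theorem Pairing.card_augment_le (P : G.Pairing) :
    P.augment.E.card ≤ G.E.card + Fintype.card (A ⊕ B) := by
  have h1 : P.S.card ≤ Fintype.card A := by
    rw [← Finset.card_image_of_injOn (f := Prod.fst)
      (fun e he f hf h => P.disjoint e he f hf (Or.inl h))]
    exact Finset.card_le_univ _
  have h2 : P.augment.E.card ≤ G.E.card + P.S.card := Finset.card_union_le _ _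
  rw [Fintype.card_sum]
  omega

/-! ### Instances in which all vertices of one side are stable -/

/-- Every popular matching covers B and so has |B| edges. The A-side of a stable matching is
contained in that of N, and equal cardinalities force equality. -/
theorem IsPopular.matched_iff (hB : ∀ b, G.StableVertex (Sum.inr b)) {N : Finset (A × B)}
    (hN : G.IsPopular N) (u : A ⊕ B) : Matched N u ↔ G.StableVertex u := by
  refine ⟨fun h => ?_, hN.matched_of_stableVertex⟩
  cases u with
  | inr b => exact hB b
  | inl a =>
    obtain ⟨M, hM⟩ := G.exists_isStable
    have hsub : M.image Prod.fst ⊆ N.image Prod.fst := by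
      intro a' ha'
      obtain ⟨⟨a'', b⟩, he, rfl⟩ := Finset.mem_image.1 ha'
      obtain ⟨b', hb'⟩ := hN.matched_of_stableVertex (u := Sum.inl a'') ⟨M, hM, b, he⟩
      exact Finset.mem_image.2 ⟨_, hb', rfl⟩
    have hcard : ∀ M, G.IsPopular M → (M.image Prod.fst).card = Fintype.card B := fun M hM => by
      rw [Finset.card_image_of_injOn (fun e he f hf h => hM.1.2 e he f hf (Or.inl h))]
      exact hM.1.card_eq fun b => hM.matched_of_stableVertex (hB b)
    have heq := Finset.eq_of_subset_of_card_le hsub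
      (by rw [hcard N hN, hcard M hM.isPopular])
    obtain ⟨b, hb⟩ := h
    have : a ∈ M.image Prod.fst := heq ▸ Finset.mem_image.2 ⟨_, hb, rfl⟩
    obtain ⟨⟨a', b'⟩, he, rfl⟩ := Finset.mem_image.1 this
    exact ⟨M, hM, b', he⟩

/-- N already has |B| edges, so there is no larger matching to compare with. -/
theorem IsPopular.isDominant (hB : ∀ b, G.StableVertex (Sum.inr b)) {N : Finset (A × B)}
    (hN : G.IsPopular N) : G.IsDominant N := by
  refine ⟨hN, fun M hM h => ?_⟩
  have h1 := hN.1.card_eq fun b => hN.matched_of_stableVertex (hB b)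
  have h2 := hM.card_le
  omega

theorem popularVertex_iff (hB : ∀ b, G.StableVertex (Sum.inr b)) (u : A ⊕ B) :
    G.PopularVertex u ↔ G.StableVertex u := by
  refine ⟨fun ⟨M, hM, hu⟩ => (hM.1.matched_iff hB u).1 hu, fun hu => ?_⟩
  obtain ⟨M, hM, hMu⟩ := hu
  refine ⟨M, ⟨hM.isPopular, fun N hN => ?_⟩, hMu⟩
  rw [hM.1.card_eq fun b => hM.isPopular.matched_of_stableVertex (hB b)]
  exact hN.1.card_le

theorem DominantEdge.stableVertex (hB : ∀ b, G.StableVertex (Sum.inr b)) {e : A × B}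
    (he : G.DominantEdge e) : G.StableVertex (Sum.inl e.1) := by
  obtain ⟨M, hM, heM⟩ := he
  exact (hM.1.matched_iff hB _).1 ⟨e.2, heM⟩

/-- In a popular matching, a vertex `b` adjacent to an unmatched vertex `a` and matched to `a'`
prefers `a'` to `a`. -/
theorem IsPopular.rkB_lt {M : Finset (A × B)} (hM : G.IsPopular M) {a a' : A} {b : B}
    (hab : (a, b) ∈ G.E) (ha : ¬ Matched M (Sum.inl a)) (hb : (a', b) ∈ M) :
    G.rkB b a' < G.rkB b a := by
  by_contra! hle
  have hne : a ≠ a' := fun h => ha ⟨b, h ▸ hb⟩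
  have hlt : G.rkB b a < G.rkB b a' :=
    lt_of_le_of_ne hle fun h => hne (G.rkB_inj b a a' hab (hM.1.1 hb) h)
  have hmem : ∀ c d, (c, d) ∈ insert (a, b) (M.erase (a', b)) ↔
      (c = a ∧ d = b) ∨ ((c, d) ∈ M ∧ d ≠ b) := by
    intro c d
    simp only [Finset.mem_insert, Finset.mem_erase, Prod.mk.injEq, ne_eq]
    refine or_congr Iff.rfl ⟨fun ⟨h1, h2⟩ => ⟨h2, fun h => h1 ⟨?_, h⟩⟩,
      fun ⟨h1, h2⟩ => ⟨fun h => h2 h.2, h1⟩⟩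
    exact hM.1.eq_left (show (c, b) ∈ M from h ▸ h2) hb
  -- Rematching b from a' to a wins the votes of a and b and can lose only that of a'.
  set N := insert (a, b) (M.erase (a', b)) with hNdef
  have hN : G.IsMatching N := by
    refine ⟨Finset.insert_subset hab ((Finset.erase_subset _ _).trans hM.1.1), ?_⟩
    rintro ⟨c, d⟩ h1 ⟨c', d'⟩ h2 h
    rw [hmem] at h1 h2
    simp only at h
    rcases h1 with ⟨rfl, rfl⟩ | ⟨h1, h1'⟩ <;> rcases h2 with ⟨rfl, rfl⟩ | ⟨h2, h2'⟩
    · rfl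
    · rcases h with rfl | rfl
      · exact absurd ⟨_, h2⟩ ha
      · exact absurd rfl h2'
    · rcases h with rfl | rfl
      · exact absurd ⟨_, h1⟩ ha
      · exact absurd rfl h1'
    · exact hM.1.2 _ h1 _ h2 h
  have h1 : G.phi M N ≤ 1 := by
    refine Finset.card_le_one.2 ?_
    suffices h : ∀ u, G.Prefers M N u → u = Sum.inl a' by
      intro u hu v hv
      rw [h u (Finset.mem_filter.1 hu).2, h v (Finset.mem_filter.1 hv).2]
    rintro (c | d) ⟨v, hv, hv'⟩
    · by_cases hvb : v = b
      · rw [hM.1.eq_left (show (c, b) ∈ M from hvb ▸ hv) hb]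
      · exact absurd (hv' v ((hmem _ _).2 (Or.inr ⟨hv, hvb⟩))) (lt_irrefl _)
    · by_cases hdb : d = b
      · subst hdb
        rw [hM.1.eq_left hv hb] at hv'
        exact absurd (hv' a ((hmem _ _).2 (Or.inl ⟨rfl, rfl⟩))) hlt.asymm
      · exact absurd (hv' v ((hmem _ _).2 (Or.inr ⟨hv, hdb⟩))) (lt_irrefl _)
  have h2 : 1 < G.phi N M := by
    refine Finset.one_lt_card.2 ⟨Sum.inl a, ?_, Sum.inr b, ?_, by simp⟩
    · exact Finset.mem_filter.2 ⟨Finset.mem_univ _, b, (hmem _ _).2 (Or.inl ⟨rfl, rfl⟩),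
        fun c hc => absurd ⟨c, hc⟩ ha⟩
    · refine Finset.mem_filter.2 ⟨Finset.mem_univ _, a, (hmem _ _).2 (Or.inl ⟨rfl, rfl⟩),
        fun c hc => ?_⟩
      rwa [hM.1.eq_left hc hb]
  have := hM.2 N hN
  omega

end MarriageInstance

/-! ### Prefix sums of ranked families -/

section PrefixSum

variable {ι : Type*}

/-- The total weight of the members of `s` of rank less than `k`. -/
noncomputable def prefixSum (s : Finset ι) (r : ι → ℕ) (x : ι → ℝ) (k : ℕ) : ℝ :=
  ∑ f ∈ s with r f < k, x f

variable {s : Finset ι} {r : ι → ℕ} {x : ι → ℝ}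

theorem prefixSum_nonneg (hx : ∀ f ∈ s, 0 ≤ x f) (k : ℕ) : 0 ≤ prefixSum s r x k :=
  Finset.sum_nonneg fun f hf => hx f (Finset.mem_filter.1 hf).1

theorem prefixSum_mono (hx : ∀ f ∈ s, 0 ≤ x f) {k l : ℕ} (h : k ≤ l) :
    prefixSum s r x k ≤ prefixSum s r x l :=
  Finset.sum_le_sum_of_subset_of_nonneg
    (Finset.monotone_filter_right _ fun _ _ hf => lt_of_lt_of_le hf h)
    fun f hf _ => hx f (Finset.mem_filter.1 hf).1

theorem prefixSum_le_sum (hx : ∀ f ∈ s, 0 ≤ x f) (k : ℕ) : prefixSum s r x k ≤ ∑ f ∈ s, x f :=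
  Finset.sum_le_sum_of_subset_of_nonneg (Finset.filter_subset _ _) fun f hf _ => hx f hf

theorem prefixSum_succ (hr : Set.InjOn r s) {e : ι} (he : e ∈ s) :
    prefixSum s r x (r e + 1) = prefixSum s r x (r e) + x e := by
  have : s.filter (fun f => r f < r e + 1) = insert e (s.filter fun f => r f < r e) := by
    ext f
    simp only [Finset.mem_filter, Finset.mem_insert]
    constructor
    · rintro ⟨hf, h⟩
      rcases Nat.lt_succ_iff_lt_or_eq.1 h with h | h
      · exact Or.inr ⟨hf, h⟩
      · exact Or.inl (hr hf he h)
    · rintro (rfl | ⟨hf, h⟩)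
      · exact ⟨he, Nat.lt_succ_self _⟩
      · exact ⟨hf, h.trans (Nat.lt_succ_self _)⟩
  rw [prefixSum, this, Finset.sum_insert (by simp), add_comm]
  rfl

theorem prefixSum_add_le (hx : ∀ f ∈ s, 0 ≤ x f) (hr : Set.InjOn r s) {e : ι} (he : e ∈ s) {k : ℕ}
    (h : r e < k) : prefixSum s r x (r e) + x e ≤ prefixSum s r x k := by
  rw [← prefixSum_succ hr he]
  exact prefixSum_mono hx h

theorem prefixSum_add_le_sum (hx : ∀ f ∈ s, 0 ≤ x f) (hr : Set.InjOn r s) {e : ι} (he : e ∈ s) :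
    prefixSum s r x (r e) + x e ≤ ∑ f ∈ s, x f := by
  rw [← prefixSum_succ hr he]
  exact prefixSum_le_sum hx _

theorem sum_filter_lt_eq (hr : Set.InjOn r s) {e : ι} (he : e ∈ s) :
    ∑ f ∈ s with r e < r f, x f = ∑ f ∈ s, x f - x e - prefixSum s r x (r e) := by
  have h := prefixSum_succ (x := x) hr he
  have h' := Finset.sum_filter_add_sum_filter_not s (fun f => r f < r e + 1) x
  have h'' : s.filter (fun f => ¬ r f < r e + 1) = s.filter fun f => r e < r f :=
    Finset.filter_congr fun f _ => by omega
  rw [h''] at h'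
  unfold prefixSum at h ⊢
  linarith

/-- Any threshold property that fails at `0` and holds at the total weight changes in one cell. -/
theorem exists_cell (hr : Set.InjOn r s) (P : ℝ → Prop) (h0 : ¬ P 0) (h1 : P (∑ f ∈ s, x f)) :
    ∃ e ∈ s, ¬ P (prefixSum s r x (r e)) ∧ P (prefixSum s r x (r e) + x e) := by
  have hex : ∃ k, P (prefixSum s r x k) := by
    refine ⟨s.sup r + 1, ?_⟩
    rwa [prefixSum, Finset.filter_true_of_mem]
    exact fun f hf => Nat.lt_succ_of_le (Finset.le_sup hf)
  have hk := Nat.find_spec hex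
  have hmin : ∀ j < Nat.find hex, ¬ P (prefixSum s r x j) := fun j hj => Nat.find_min hex hj
  rcases hkj : Nat.find hex with _ | j
  · rw [hkj] at hk
    simp [prefixSum] at hk
    exact absurd hk h0
  · rw [hkj] at hk hmin
    have hj := hmin j (Nat.lt_succ_self j)
    -- If no member had rank j, the prefix sums at j and j + 1 would coincide.
    obtain ⟨e, he, hej⟩ : ∃ e ∈ s, r e = j := by
      by_contra! hc
      apply hj
      convert hk using 1
      unfold prefixSum
      congr 1
      exact Finset.filter_congr fun f hf => by have := hc f hf; omega
    subst hej
    refine ⟨e, he, hj, ?_⟩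
    rwa [← prefixSum_succ hr he]

/-- Exchanging e and f in the double sum swaps its two halves: a vertex is indifferent between its
fractional assignment and itself. -/
theorem sum_mul_antisymm :
    ∑ e ∈ s, x e * (∑ f ∈ s with r e < r f, x f - ∑ f ∈ s with r f < r e, x f) = 0 := by
  simp_rw [mul_sub, Finset.sum_sub_distrib, Finset.sum_filter, Finset.mul_sum]
  rw [sub_eq_zero, Finset.sum_comm]
  refine Finset.sum_congr rfl fun e _ => Finset.sum_congr rfl fun f _ => ?_
  split_ifs <;> ring

end PrefixSum

/-! ### Agreement of the two ends of an edge on a threshold -/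

theorem fract_sub_eq_ite {t q : ℝ} (ht : 0 ≤ t) (ht' : t < 1) (hq : 0 ≤ q) (hq' : q ≤ 1) :
    Int.fract (t - q) = if t < q then t - q + 1 else t - q := by
  rw [Int.fract_eq_iff]
  split_ifs with h
  · exact ⟨by linarith, by linarith, -1, by push_cast; ring⟩
  · exact ⟨by linarith, by linarith, 0, by push_cast; ring⟩

theorem one_sub_fract_add_eq_ite {t q : ℝ} (ht : 0 ≤ t) (ht' : t < 1) (hq : 0 ≤ q) (hq' : q ≤ 1) :
    1 - Int.fract (t + q) = if t < 1 - q then 1 - q - t else 2 - q - t := by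
  have : Int.fract (t + q) = if t < 1 - q then t + q else t + q - 1 := by
    rw [Int.fract_eq_iff]
    split_ifs with h
    · exact ⟨by linarith, by linarith, 0, by push_cast; ring⟩
    · exact ⟨by linarith, by linarith, 1, by push_cast; ring⟩
  rw [this]
  split_ifs <;> ring

/-- If t lies on the same side of qa and of 1 - qb, the two positions add up to ca + x + cb, and
reflection carries the cell [ca, ca + x) onto (cb, cb + x]. On different sides the sum is off by 1
and neither position can lie in its cell. -/
theorem cell_iff_cell {t x ca cb qa qb : ℝ} (ht : 0 ≤ t) (ht' : t < 1) (hqa : 0 ≤ qa)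
    (hqa' : qa ≤ 1) (hqb : 0 ≤ qb) (hqb' : qb ≤ 1) (hca : 0 ≤ ca) (hcb : 0 ≤ cb)
    (hcax : ca + x ≤ 1) (hcbx : cb + x ≤ 1) (h : ca + x + cb + qa + qb = 2) :
    (ca ≤ Int.fract (t - qa) ∧ Int.fract (t - qa) < ca + x) ↔
      (cb < 1 - Int.fract (t + qb) ∧ 1 - Int.fract (t + qb) ≤ cb + x) := by
  rw [fract_sub_eq_ite ht ht' hqa hqa', one_sub_fract_add_eq_ite ht ht' hqb hqb']
  split_ifs <;> constructor <;> rintro ⟨h1, h2⟩ <;> constructor <;> linarith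

/-- This makes the rounded multipliers at the two ends of a chosen edge opposite. -/
theorem lt_iff_lt_of_cell {t x ca cb qa qb : ℝ} (ht : 0 ≤ t) (ht' : t < 1) (hqa : 0 ≤ qa)
    (hqa' : qa ≤ 1) (hcb : 0 ≤ cb)
    (hcbx : cb + x ≤ 1) (h : ca + x + cb + qa + qb = 2)
    (h' : ca ≤ Int.fract (t - qa) ∧ Int.fract (t - qa) < ca + x) :
    t < qa ↔ t < 1 - qb := by
  rw [fract_sub_eq_ite ht ht' hqa hqa'] at h'
  split_ifs at h' with h1 <;> constructor <;> intro h2 <;> linarith [h'.1, h'.2]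

namespace MarriageInstance

variable {A : Type*} {B : Type*} {G : MarriageInstance A B}

/-! ### Fractional matchings and votes -/

theorem mem_delta_inl {a : A} {e : G.Edge} : e ∈ G.delta (Sum.inl a) ↔ e.1.1 = a := by
  simp [delta]

theorem mem_delta_inr {b : B} {e : G.Edge} : e ∈ G.delta (Sum.inr b) ↔ e.1.2 = b := by
  simp [delta]

theorem injOn_rkA (a : A) :
    Set.InjOn (fun e : G.Edge => G.rkA a e.1.2) (G.delta (Sum.inl a)) := by
  rintro ⟨⟨a', b⟩, he⟩ h1 ⟨⟨a'', b'⟩, hf⟩ h2 h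
  obtain rfl : a' = a := mem_delta_inl.1 h1
  obtain rfl : a'' = a' := mem_delta_inl.1 h2
  have := G.rkA_inj _ b b' he hf h
  subst this
  rfl

theorem injOn_rkB (b : B) :
    Set.InjOn (fun e : G.Edge => G.rkB b e.1.1) (G.delta (Sum.inr b)) := by
  rintro ⟨⟨a, b'⟩, he⟩ h1 ⟨⟨a', b''⟩, hf⟩ h2 h
  obtain rfl : b' = b := mem_delta_inr.1 h1
  obtain rfl : b'' = b' := mem_delta_inr.1 h2
  have := G.rkB_inj _ a a' he hf h
  subst this
  rfl

/-- The weight of the edges at the first endpoint of `e` that it prefers to `e`. -/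
noncomputable def aboveA (x : G.Edge → ℝ) (e : G.Edge) : ℝ :=
  prefixSum (G.delta (Sum.inl e.1.1)) (fun f => G.rkA e.1.1 f.1.2) x (G.rkA e.1.1 e.1.2)

/-- The weight of the edges at the second endpoint of `e` that it prefers to `e`. -/
noncomputable def aboveB (x : G.Edge → ℝ) (e : G.Edge) : ℝ :=
  prefixSum (G.delta (Sum.inr e.1.2)) (fun f => G.rkB e.1.2 f.1.1) x (G.rkB e.1.2 e.1.1)

/-- The self-loop term vanishes, and the weight ranked below e is what x e and the weight above
leave of 1. -/
theorem voteA_eq {x : G.Edge → ℝ} (e : G.Edge) (h : ∑ f ∈ G.delta (Sum.inl e.1.1), x f = 1) :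
    G.voteA x e.1.1 e.1.2 = 1 - x e - 2 * aboveA x e := by
  have := sum_filter_lt_eq (x := x) (injOn_rkA e.1.1) (mem_delta_inl.2 (rfl : e.1.1 = e.1.1))
  unfold voteA
  rw [this, h, aboveA, prefixSum]
  ring

theorem voteB_eq {x : G.Edge → ℝ} (e : G.Edge) (h : ∑ f ∈ G.delta (Sum.inr e.1.2), x f = 1) :
    G.voteB x e.1.2 e.1.1 = 1 - x e - 2 * aboveB x e := by
  have := sum_filter_lt_eq (x := x) (injOn_rkB e.1.2) (mem_delta_inr.2 (rfl : e.1.2 = e.1.2))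
  unfold voteB
  rw [this, h, aboveB, prefixSum]
  ring

theorem sum_mul_voteA {x : G.Edge → ℝ} {a : A} (h : ∑ f ∈ G.delta (Sum.inl a), x f = 1) :
    ∑ e ∈ G.delta (Sum.inl a), x e * G.voteA x a e.1.2 = 0 := by
  rw [← sum_mul_antisymm (s := G.delta (Sum.inl a)) (r := fun e => G.rkA a e.1.2) (x := x)]
  refine Finset.sum_congr rfl fun e _ => ?_
  rw [voteA, h, sub_self, zero_add]

theorem sum_mul_voteB {x : G.Edge → ℝ} {b : B} (h : ∑ f ∈ G.delta (Sum.inr b), x f = 1) :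
    ∑ e ∈ G.delta (Sum.inr b), x e * G.voteB x b e.1.1 = 0 := by
  rw [← sum_mul_antisymm (s := G.delta (Sum.inr b)) (r := fun e => G.rkB b e.1.1) (x := x)]
  refine Finset.sum_congr rfl fun e _ => ?_
  rw [voteB, h, sub_self, zero_add]

/-! ### Incidence vectors of matchings -/

theorem sum_incidence_inl {M : Finset (A × B)} (hM : G.IsMatching M) {a : A} {b : B}
    (hab : (a, b) ∈ M) (Q : B → Prop) [DecidablePred Q] :
    ∑ e ∈ (G.delta (Sum.inl a)).filter (fun e => Q e.1.2), G.incidence M e =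
      if Q b then 1 else 0 := by
  rw [Finset.sum_filter, Finset.sum_eq_single (⟨(a, b), hM.1 hab⟩ : G.Edge)]
  · simp [incidence, hab]
  · rintro ⟨⟨a', b'⟩, he⟩ h1 h2
    obtain rfl : a' = a := mem_delta_inl.1 h1
    have : (a', b') ∉ M := fun h => h2 (by simp [hM.eq_right h hab])
    simp [incidence, this]
  · exact fun h => absurd (mem_delta_inl.2 rfl) h

theorem sum_incidence_inr {M : Finset (A × B)} (hM : G.IsMatching M) {a : A} {b : B}
    (hab : (a, b) ∈ M) (Q : A → Prop) [DecidablePred Q] :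
    ∑ e ∈ (G.delta (Sum.inr b)).filter (fun e => Q e.1.1), G.incidence M e =
      if Q a then 1 else 0 := by
  rw [Finset.sum_filter, Finset.sum_eq_single (⟨(a, b), hM.1 hab⟩ : G.Edge)]
  · simp [incidence, hab]
  · rintro ⟨⟨a', b'⟩, he⟩ h1 h2
    obtain rfl : b' = b := mem_delta_inr.1 h1
    have : (a', b') ∉ M := fun h => h2 (by simp [hM.eq_left h hab])
    simp [incidence, this]
  · exact fun h => absurd (mem_delta_inr.2 rfl) h

theorem sum_incidence_of_matched {M : Finset (A × B)} (hM : G.IsMatching M) {u : A ⊕ B}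
    (hu : Matched M u) : ∑ e ∈ G.delta u, G.incidence M e = 1 := by
  cases u with
  | inl a =>
    obtain ⟨b, hb⟩ := hu
    simpa using sum_incidence_inl hM hb fun _ => True
  | inr b =>
    obtain ⟨a, ha⟩ := hu
    simpa using sum_incidence_inr hM ha fun _ => True

theorem voteA_incidence {M : Finset (A × B)} (hM : G.IsMatching M) {a : A}
    (ha : Matched M (Sum.inl a)) (b : B) : G.voteA (G.incidence M) a b = G.signA M a b := by
  have h := sum_incidence_of_matched hM ha
  obtain ⟨c, hc⟩ := ha
  have h1 : G.VotesForA M a b ↔ G.rkA a b < G.rkA a c :=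
    ⟨fun h => h c hc, fun h c' hc' => hM.eq_right hc hc' ▸ h⟩
  have h2 : G.VotesAgainstA M a b ↔ G.rkA a c < G.rkA a b :=
    ⟨fun ⟨c', hc', h⟩ => hM.eq_right hc' hc ▸ h, fun h => ⟨c, hc, h⟩⟩
  unfold voteA signA
  rw [h, sum_incidence_inl hM hc fun b' => G.rkA a b < G.rkA a b',
    sum_incidence_inl hM hc fun b' => G.rkA a b' < G.rkA a b]
  simp only [h1, h2]
  ring

theorem voteB_incidence {M : Finset (A × B)} (hM : G.IsMatching M) {b : B}
    (hb : Matched M (Sum.inr b)) (a : A) : G.voteB (G.incidence M) b a = G.signB M b a := by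
  have h := sum_incidence_of_matched hM hb
  obtain ⟨c, hc⟩ := hb
  have h1 : G.VotesForB M b a ↔ G.rkB b a < G.rkB b c :=
    ⟨fun h => h c hc, fun h c' hc' => hM.eq_left hc hc' ▸ h⟩
  have h2 : G.VotesAgainstB M b a ↔ G.rkB b c < G.rkB b a :=
    ⟨fun ⟨c', hc', h⟩ => hM.eq_left hc' hc ▸ h, fun h => ⟨c, hc, h⟩⟩
  unfold voteB signB
  rw [h, sum_incidence_inr hM hc fun b' => G.rkB b a < G.rkB b b',
    sum_incidence_inr hM hc fun b' => G.rkB b b' < G.rkB b a]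
  simp only [h1, h2]
  ring

variable [Fintype A] [Fintype B]

/-- Edges of M have weight 0 and unmatched vertices have loop weight 0, so both groups contribute
nonnegatively to a sum that is 0. -/
theorem IsWitness.eq_zero_of_not_matched {M : Finset (A × B)} (hM : G.IsMatching M)
    {α : A ⊕ B → ℝ} (h : G.IsWitness M α) {u : A ⊕ B} (hu : ¬ Matched M u) : α u = 0 := by
  have h1 := hM.sum_eq α
  rw [h.2.1] at h1
  have h2 : 0 ≤ ∑ e ∈ M, (α (Sum.inl e.1) + α (Sum.inr e.2)) :=
    Finset.sum_nonneg fun e he => by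
      have := h.2.2.1 e.1 e.2 (hM.1 he)
      rwa [wtM, if_pos he] at this
  have h3 : ∀ v ∈ Finset.univ.filter (fun v => ¬ Matched M v), 0 ≤ α v := fun v hv => by
    have := h.2.2.2 v
    rwa [wtLoop, if_neg (Finset.mem_filter.1 hv).2] at this
  have h4 := Finset.single_le_sum h3 (Finset.mem_filter.2 ⟨Finset.mem_univ u, hu⟩)
  have h5 := h3 u (Finset.mem_filter.2 ⟨Finset.mem_univ u, hu⟩)
  linarith

/-- Popular matchings with a witness that does not vanish on stable vertices give points of the
polytope. -/
theorem IsWitness.mem_polytopeC (hB : ∀ b, G.StableVertex (Sum.inr b)) {M : Finset (A × B)}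
    (hM : G.IsPopular M) {α : A ⊕ B → ℝ} (h : G.IsWitness M α)
    (hα : ∀ u, G.StableVertex u → α u = 1 ∨ α u = -1) :
    (G.incidence M, α) ∈ G.polytopeC := by
  refine ⟨h.2.1, fun a b hab => ?_, fun u => ?_, fun u hu => ?_, fun u hu => ?_, fun e he => ?_,
    fun e _ => ?_⟩
  · have hwt := h.2.2.1 a b hab
    unfold cWt
    split_ifs with ha
    · rwa [wt, voteA_incidence hM.1 ((hM.matched_iff hB _).2 ha),
        voteB_incidence hM.1 ((hM.matched_iff hB _).2 (hB b)), ← hM.1.wtM_eq hab]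
    · have ha' : ¬ Matched M (Sum.inl a) := fun h => ha ((hM.matched_iff hB _).1 h)
      have h0 := h.eq_zero_of_not_matched hM.1 ha'
      have h1 : 0 ≤ G.wtM M a b := wtM_nonneg fun h => ha' ⟨h.1.choose, h.1.choose_spec.1⟩
      simp only [h0, zero_add] at hwt ⊢
      -- An unmatched a has multiplier 0 and cannot vote against b, so the multiplier of b is
      -- nonnegative; being ±1, it is the required 1.
      rcases hα _ (hB b) with h2 | h2 <;> rw [h2] at hwt ⊢
      linarith
  · rcases h.1 u with h | h | h <;> simp only [h] <;> norm_num
  · exact h.eq_zero_of_not_matched hM.1 fun h => hu ((hM.matched_iff hB _).1 h)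
  · exact sum_incidence_of_matched hM.1 (hM.matched_of_stableVertex hu)
  · exact if_neg fun h => he ⟨M, hM.isDominant hB, h⟩
  · simp only [incidence]; split_ifs <;> norm_num

/-! ### Points of the polytope -/

variable {p : (G.Edge → ℝ) × (A ⊕ B → ℝ)}

theorem polytopeC_nonneg (hp : p ∈ G.polytopeC) (e : G.Edge) : 0 ≤ p.1 e := by
  by_cases h : G.DominantEdge e.1
  · exact hp.2.2.2.2.2.2 e h
  · exact (hp.2.2.2.2.2.1 e h).ge

theorem polytopeC_eq_zero (hB : ∀ b, G.StableVertex (Sum.inr b)) (hp : p ∈ G.polytopeC)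
    {e : G.Edge} (he : ¬ G.StableVertex (Sum.inl e.1.1)) : p.1 e = 0 :=
  hp.2.2.2.2.2.1 e fun h => he (h.stableVertex hB)

/-- Regrouped by vertices, the multipliers contribute their total, 0: x sums to 1 at stable vertices
and α vanishes at the others. The votes cancel at each vertex by antisymmetry. -/
theorem polytopeC_sum_mul (hB : ∀ b, G.StableVertex (Sum.inr b)) (hp : p ∈ G.polytopeC) :
    ∑ e : G.Edge, p.1 e *
      (p.2 (Sum.inl e.1.1) + p.2 (Sum.inr e.1.2) - G.wt p.1 e.1.1 e.1.2) = 0 := by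
  have hA : ∀ f : A → B → ℝ, ∑ e : G.Edge, p.1 e * f e.1.1 e.1.2 =
      ∑ a, ∑ e ∈ G.delta (Sum.inl a), p.1 e * f a e.1.2 := fun f => by
    rw [← Finset.sum_fiberwise Finset.univ (fun e : G.Edge => e.1.1)]
    refine Finset.sum_congr rfl fun a _ => Finset.sum_congr rfl fun e he => ?_
    rw [(Finset.mem_filter.1 he).2]
  have hB' : ∀ f : A → B → ℝ, ∑ e : G.Edge, p.1 e * f e.1.1 e.1.2 =
      ∑ b, ∑ e ∈ G.delta (Sum.inr b), p.1 e * f e.1.1 b := fun f => by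
    rw [← Finset.sum_fiberwise Finset.univ (fun e : G.Edge => e.1.2)]
    refine Finset.sum_congr rfl fun a _ => Finset.sum_congr rfl fun e he => ?_
    rw [(Finset.mem_filter.1 he).2]
  have hα : ∀ u, ∑ e ∈ G.delta u, p.1 e * p.2 u = p.2 u := fun u => by
    rw [← Finset.sum_mul]
    by_cases hu : G.StableVertex u
    · rw [hp.2.2.2.2.1 u hu, one_mul]
    · rw [hp.2.2.2.1 u hu, mul_zero]
  have hvA : ∀ a, ∑ e ∈ G.delta (Sum.inl a), p.1 e * G.voteA p.1 a e.1.2 = 0 := fun a => by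
    by_cases ha : G.StableVertex (Sum.inl a)
    · exact sum_mul_voteA (hp.2.2.2.2.1 _ ha)
    · refine Finset.sum_eq_zero fun e he => ?_
      rw [polytopeC_eq_zero hB hp (by rwa [mem_delta_inl.1 he]), zero_mul]
  have hvB : ∀ b, ∑ e ∈ G.delta (Sum.inr b), p.1 e * G.voteB p.1 b e.1.1 = 0 := fun b =>
    sum_mul_voteB (hp.2.2.2.2.1 _ (hB b))
  have hsum := hp.1
  rw [Fintype.sum_sum_type] at hsum
  simp only [wt, mul_sub, mul_add, Finset.sum_sub_distrib, Finset.sum_add_distrib]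
  rw [hA fun a _ => p.2 (Sum.inl a), hB' fun _ b => p.2 (Sum.inr b), hA fun a b => G.voteA p.1 a b,
    hB' fun a b => G.voteB p.1 b a]
  simp only [hα, hvA, hvB, hsum, Finset.sum_const_zero]
  norm_num

/-- Complementary slackness. -/
theorem polytopeC_slack (hB : ∀ b, G.StableVertex (Sum.inr b)) (hp : p ∈ G.polytopeC)
    {e : G.Edge} (he : 0 < p.1 e) :
    p.2 (Sum.inl e.1.1) + p.2 (Sum.inr e.1.2) = G.wt p.1 e.1.1 e.1.2 := by
  have h := (Finset.sum_eq_zero_iff_of_nonneg (fun f _ => ?_)).1 (polytopeC_sum_mul hB hp) e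
    (Finset.mem_univ e)
  · rcases mul_eq_zero.1 h with h | h
    · exact absurd h he.ne'
    · linarith
  · by_cases hf : G.StableVertex (Sum.inl f.1.1)
    · have := hp.2.1 f.1.1 f.1.2 f.2
      rw [cWt, if_pos hf] at this
      exact mul_nonneg (polytopeC_nonneg hp f) (by linarith)
    · rw [polytopeC_eq_zero hB hp hf, zero_mul]

theorem polytopeC_wt (hB : ∀ b, G.StableVertex (Sum.inr b)) (hp : p ∈ G.polytopeC)
    {e : G.Edge} (he : G.StableVertex (Sum.inl e.1.1)) :
    G.wt p.1 e.1.1 e.1.2 = 2 - 2 * (aboveA p.1 e + p.1 e + aboveB p.1 e) := by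
  rw [wt, voteA_eq e (hp.2.2.2.2.1 _ he), voteB_eq e (hp.2.2.2.2.1 _ (hB _))]
  ring

theorem aboveA_nonneg (hp : p ∈ G.polytopeC) (e : G.Edge) : 0 ≤ aboveA p.1 e :=
  prefixSum_nonneg (fun f _ => polytopeC_nonneg hp f) _

theorem aboveB_nonneg (hp : p ∈ G.polytopeC) (e : G.Edge) : 0 ≤ aboveB p.1 e :=
  prefixSum_nonneg (fun f _ => polytopeC_nonneg hp f) _

theorem aboveA_add_le (hp : p ∈ G.polytopeC) {e : G.Edge}
    (he : G.StableVertex (Sum.inl e.1.1)) : aboveA p.1 e + p.1 e ≤ 1 := by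
  rw [← hp.2.2.2.2.1 _ he]
  exact prefixSum_add_le_sum (fun f _ => polytopeC_nonneg hp f) (injOn_rkA e.1.1)
    (mem_delta_inl.2 (rfl : e.1.1 = e.1.1))

theorem aboveB_add_le (hB : ∀ b, G.StableVertex (Sum.inr b)) (hp : p ∈ G.polytopeC)
    (e : G.Edge) : aboveB p.1 e + p.1 e ≤ 1 := by
  rw [← hp.2.2.2.2.1 _ (hB e.1.2)]
  exact prefixSum_add_le_sum (fun f _ => polytopeC_nonneg hp f) (injOn_rkB e.1.2)
    (mem_delta_inr.2 (rfl : e.1.2 = e.1.2))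

theorem aboveA_add_le_aboveA (hp : p ∈ G.polytopeC) {e f : G.Edge} (h : e.1.1 = f.1.1)
    (hlt : G.rkA f.1.1 e.1.2 < G.rkA f.1.1 f.1.2) : aboveA p.1 e + p.1 e ≤ aboveA p.1 f := by
  rw [← h] at hlt
  unfold aboveA
  rw [← h]
  exact prefixSum_add_le (fun f _ => polytopeC_nonneg hp f) (injOn_rkA e.1.1)
    (mem_delta_inl.2 rfl) hlt

theorem aboveB_add_le_aboveB (hp : p ∈ G.polytopeC) {e f : G.Edge} (h : e.1.2 = f.1.2)
    (hlt : G.rkB f.1.2 e.1.1 < G.rkB f.1.2 f.1.1) : aboveB p.1 e + p.1 e ≤ aboveB p.1 f := by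
  rw [← h] at hlt
  unfold aboveB
  rw [← h]
  exact prefixSum_add_le (fun f _ => polytopeC_nonneg hp f) (injOn_rkB e.1.2)
    (mem_delta_inr.2 rfl) hlt

theorem exists_cellA (hp : p ∈ G.polytopeC) {a : A} (ha : G.StableVertex (Sum.inl a))
    (P : ℝ → Prop) (h0 : ¬ P 0) (h1 : P 1) :
    ∃ b, ∃ h : (a, b) ∈ G.E, ¬ P (aboveA p.1 ⟨(a, b), h⟩) ∧
      P (aboveA p.1 ⟨(a, b), h⟩ + p.1 ⟨(a, b), h⟩) := by
  obtain ⟨⟨⟨a', b⟩, he⟩, hmem, h⟩ := exists_cell (x := p.1) (injOn_rkA a) P h0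
    (by rwa [hp.2.2.2.2.1 _ ha])
  obtain rfl : a' = a := mem_delta_inl.1 hmem
  exact ⟨b, he, h⟩

theorem exists_cellB (hB : ∀ b, G.StableVertex (Sum.inr b)) (hp : p ∈ G.polytopeC) (b : B)
    (P : ℝ → Prop) (h0 : ¬ P 0) (h1 : P 1) :
    ∃ a, ∃ h : (a, b) ∈ G.E, ¬ P (aboveB p.1 ⟨(a, b), h⟩) ∧
      P (aboveB p.1 ⟨(a, b), h⟩ + p.1 ⟨(a, b), h⟩) := by
  obtain ⟨⟨⟨a, b'⟩, he⟩, hmem, h⟩ := exists_cell (x := p.1) (injOn_rkB b) P h0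
    (by rwa [hp.2.2.2.2.1 _ (hB b)])
  obtain rfl : b' = b := mem_delta_inr.1 hmem
  exact ⟨a, he, h⟩

/-- The fraction of thresholds at which the multiplier of `u` is rounded up to `1`. -/
noncomputable def level (p : (G.Edge → ℝ) × (A ⊕ B → ℝ)) (u : A ⊕ B) : ℝ := (1 + p.2 u) / 2

theorem level_nonneg (hp : p ∈ G.polytopeC) (u : A ⊕ B) : 0 ≤ level p u := by
  have := hp.2.2.1 u
  unfold level
  linarith

/-- Complementary slackness in terms of levels, in the form required by `cell_iff_cell`. -/
theorem polytopeC_tight (hB : ∀ b, G.StableVertex (Sum.inr b)) (hp : p ∈ G.polytopeC)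
    {e : G.Edge} (he : 0 < p.1 e) : aboveA p.1 e + p.1 e + aboveB p.1 e +
      level p (Sum.inl e.1.1) + level p (Sum.inr e.1.2) = 2 := by
  have hs : G.StableVertex (Sum.inl e.1.1) := by
    by_contra h
    exact he.ne' (polytopeC_eq_zero hB hp h)
  have h1 := polytopeC_slack hB hp he
  rw [polytopeC_wt hB hp hs] at h1
  unfold level
  linarith

theorem polytopeC_two_le (hB : ∀ b, G.StableVertex (Sum.inr b)) (hp : p ∈ G.polytopeC)
    {e : G.Edge} (hs : G.StableVertex (Sum.inl e.1.1)) : 2 ≤ aboveA p.1 e + p.1 e + aboveB p.1 e +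
      level p (Sum.inl e.1.1) + level p (Sum.inr e.1.2) := by
  have h1 := hp.2.1 e.1.1 e.1.2 e.2
  rw [cWt, if_pos hs, polytopeC_wt hB hp hs] at h1
  unfold level
  linarith

/-- No constraint bounds α above explicitly. At a stable vertex some cell of positive length ends at
1; its edge is tight, and the remaining terms of that equation are nonnegative. -/
theorem level_le_one (hB : ∀ b, G.StableVertex (Sum.inr b)) (hp : p ∈ G.polytopeC) (u : A ⊕ B) :
    level p u ≤ 1 := by
  by_cases hu : G.StableVertex u
  · cases u with
    | inl a =>
      obtain ⟨b, h, h1, h2⟩ := exists_cellA hp hu (fun y => 1 ≤ y) (by norm_num) le_rfl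
      have h3 := polytopeC_tight hB hp (e := ⟨(a, b), h⟩) (by linarith)
      have h4 := aboveB_nonneg hp ⟨(a, b), h⟩
      have h5 := level_nonneg hp (Sum.inr b)
      simp only at h3
      linarith
    | inr b =>
      obtain ⟨a, h, h1, h2⟩ := exists_cellB hB hp b (fun y => 1 ≤ y) (by norm_num) le_rfl
      have h3 := polytopeC_tight hB hp (e := ⟨(a, b), h⟩) (by linarith)
      have h4 := aboveA_nonneg hp ⟨(a, b), h⟩
      have h5 := level_nonneg hp (Sum.inl a)
      simp only at h3
      linarith
  · rw [level, hp.2.2.2.1 u hu]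
    norm_num

end MarriageInstance

namespace MarriageInstance

variable {A : Type*} {B : Type*} {G : MarriageInstance A B}
  {p : (G.Edge → ℝ) × (A ⊕ B → ℝ)} {t : ℝ}

/-! ### Rounding a point of the polytope at a threshold -/

/-- The position of the threshold `t` in the list of assignments of `a`, from best to worst. -/
noncomputable def posA (p : (G.Edge → ℝ) × (A ⊕ B → ℝ)) (t : ℝ) (a : A) : ℝ :=
  Int.fract (t - level p (Sum.inl a))

/-- The position of the threshold `t` in the list of assignments of `b`, from best to worst. -/
noncomputable def posB (p : (G.Edge → ℝ) × (A ⊕ B → ℝ)) (t : ℝ) (b : B) : ℝ :=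
  1 - Int.fract (t + level p (Sum.inr b))

/-- The edge `e` is the assignment of its first endpoint at the threshold `t`. -/
def Selected (p : (G.Edge → ℝ) × (A ⊕ B → ℝ)) (t : ℝ) (e : G.Edge) : Prop :=
  aboveA p.1 e ≤ posA p t e.1.1 ∧ posA p t e.1.1 < aboveA p.1 e + p.1 e

/-- The matching obtained by rounding `p` at the threshold `t`. -/
noncomputable def roundMatching (p : (G.Edge → ℝ) × (A ⊕ B → ℝ)) (t : ℝ) : Finset (A × B) :=
  (Finset.univ.filter fun e : G.Edge => Selected p t e).map (Function.Embedding.subtype _)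

/-- The witness obtained by rounding `p` at the threshold `t`. -/
noncomputable def roundWitness (p : (G.Edge → ℝ) × (A ⊕ B → ℝ)) (t : ℝ) : A ⊕ B → ℝ
  | Sum.inl a => if G.StableVertex (Sum.inl a) then
      (if t < level p (Sum.inl a) then 1 else -1) else 0
  | Sum.inr b => if t < 1 - level p (Sum.inr b) then -1 else 1

theorem mem_roundMatching {a : A} {b : B} :
    (a, b) ∈ roundMatching p t ↔ ∃ h : (a, b) ∈ G.E, Selected p t ⟨(a, b), h⟩ := by
  simp [roundMatching]

theorem incidence_roundMatching (e : G.Edge) :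
    G.incidence (roundMatching p t) e = Set.indicator
      (Set.Ico (aboveA p.1 e) (aboveA p.1 e + p.1 e)) 1 (posA p t e.1.1) := by
  have : e.1 ∈ roundMatching p t ↔ Selected p t e :=
    mem_roundMatching.trans ⟨fun ⟨_, h⟩ => h, fun h => ⟨e.2, h⟩⟩
  simp only [incidence, this, Set.indicator, Set.mem_Ico, Selected, Pi.one_apply]

theorem Selected.pos {e : G.Edge} (h : Selected p t e) : 0 < p.1 e := by
  have := h.1.trans_lt h.2
  linarith

variable [Fintype A] [Fintype B]

theorem Selected.dominantEdge (hp : p ∈ G.polytopeC) {e : G.Edge} (h : Selected p t e) :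
    G.DominantEdge e.1 := by
  by_contra hd
  exact h.pos.ne' (hp.2.2.2.2.2.1 e hd)

theorem Selected.stableVertex (hB : ∀ b, G.StableVertex (Sum.inr b)) (hp : p ∈ G.polytopeC)
    {e : G.Edge} (h : Selected p t e) : G.StableVertex (Sum.inl e.1.1) :=
  (h.dominantEdge hp).stableVertex hB

/-- The selected edges are also the assignments of their second endpoints. -/
theorem selected_iff (hB : ∀ b, G.StableVertex (Sum.inr b)) (hp : p ∈ G.polytopeC)
    (ht : 0 ≤ t) (ht' : t < 1) (e : G.Edge) : Selected p t e ↔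
      aboveB p.1 e < posB p t e.1.2 ∧ posB p t e.1.2 ≤ aboveB p.1 e + p.1 e := by
  by_cases he : 0 < p.1 e
  · have hs : G.StableVertex (Sum.inl e.1.1) := by
      by_contra h
      exact he.ne' (polytopeC_eq_zero hB hp h)
    exact cell_iff_cell ht ht' (level_nonneg hp _) (level_le_one hB hp _) (level_nonneg hp _)
      (level_le_one hB hp _) (aboveA_nonneg hp e) (aboveB_nonneg hp e) (aboveA_add_le hp hs)
      (aboveB_add_le hB hp e) (polytopeC_tight hB hp he)
  · refine iff_of_false (fun h => he h.pos) fun h => he ?_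
    have := h.1.trans_le h.2
    linarith

theorem Selected.lt_iff_lt (hB : ∀ b, G.StableVertex (Sum.inr b)) (hp : p ∈ G.polytopeC)
    (ht : 0 ≤ t) (ht' : t < 1) {e : G.Edge} (h : Selected p t e) :
    t < level p (Sum.inl e.1.1) ↔ t < 1 - level p (Sum.inr e.1.2) :=
  lt_iff_lt_of_cell ht ht' (level_nonneg hp _) (level_le_one hB hp _) (aboveB_nonneg hp e)
    (aboveB_add_le hB hp e) (polytopeC_tight hB hp h.pos) h

theorem exists_mem_roundMatching_left (hp : p ∈ G.polytopeC) {a : A}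
    (ha : G.StableVertex (Sum.inl a)) : ∃ b, (a, b) ∈ roundMatching p t := by
  obtain ⟨b, h, h1, h2⟩ := exists_cellA hp ha (fun y => posA p t a < y)
    (not_lt.2 (Int.fract_nonneg _)) (Int.fract_lt_one _)
  exact ⟨b, mem_roundMatching.2 ⟨h, not_lt.1 h1, h2⟩⟩

theorem exists_mem_roundMatching_right (hB : ∀ b, G.StableVertex (Sum.inr b))
    (hp : p ∈ G.polytopeC) (ht : 0 ≤ t) (ht' : t < 1) (b : B) :
    ∃ a, (a, b) ∈ roundMatching p t := by
  -- Positions on the B-side range over (0, 1], so the cells there are closed on the right; hence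
  -- the weak inequality.
  obtain ⟨a, h, h1, h2⟩ := exists_cellB hB hp b (fun y => posB p t b ≤ y)
    (not_le.2 (by have := Int.fract_lt_one (t + level p (Sum.inr b)); unfold posB; linarith))
    (by have := Int.fract_nonneg (t + level p (Sum.inr b)); unfold posB; linarith)
  exact ⟨a, mem_roundMatching.2 ⟨h, (selected_iff hB hp ht ht' _).2 ⟨not_le.1 h1, h2⟩⟩⟩

theorem isMatching_roundMatching (hB : ∀ b, G.StableVertex (Sum.inr b)) (hp : p ∈ G.polytopeC)
    (ht : 0 ≤ t) (ht' : t < 1) : G.IsMatching (roundMatching p t) := by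
  refine ⟨fun e he => (mem_roundMatching.1 he).choose, ?_⟩
  rintro ⟨a, b⟩ he ⟨a', b'⟩ hf h
  obtain ⟨he, hse⟩ := mem_roundMatching.1 he
  obtain ⟨hf, hsf⟩ := mem_roundMatching.1 hf
  rcases h with h | h <;> simp only at h <;> subst h
  · rcases lt_trichotomy (G.rkA a b) (G.rkA a b') with h | h | h
    · have := aboveA_add_le_aboveA hp (e := ⟨(a, b), he⟩) (f := ⟨(a, b'), hf⟩) rfl h
      exact absurd (hse.2.trans_le this) (not_lt.2 hsf.1)
    · rw [G.rkA_inj a b b' he hf h]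
    · have := aboveA_add_le_aboveA hp (e := ⟨(a, b'), hf⟩) (f := ⟨(a, b), he⟩) rfl h
      exact absurd (hsf.2.trans_le this) (not_lt.2 hse.1)
  · rw [selected_iff hB hp ht ht'] at hse hsf
    rcases lt_trichotomy (G.rkB b a) (G.rkB b a') with h | h | h
    · have := aboveB_add_le_aboveB hp (e := ⟨(a, b), he⟩) (f := ⟨(a', b), hf⟩) rfl h
      exact absurd (hse.2.trans this) (not_le.2 hsf.1)
    · rw [G.rkB_inj b a a' he hf h]
    · have := aboveB_add_le_aboveB hp (e := ⟨(a', b), hf⟩) (f := ⟨(a, b), he⟩) rfl h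
      exact absurd (hsf.2.trans this) (not_le.2 hse.1)

/-! ### Votes between an edge and the rounded matching -/

theorem VotesForA.le_posA (hp : p ∈ G.polytopeC) {e : G.Edge}
    (hs : G.StableVertex (Sum.inl e.1.1)) (h : G.VotesForA (roundMatching p t) e.1.1 e.1.2) :
    aboveA p.1 e + p.1 e ≤ posA p t e.1.1 := by
  obtain ⟨b, hb⟩ := exists_mem_roundMatching_left (t := t) hp hs
  obtain ⟨hE, hsel⟩ := mem_roundMatching.1 hb
  exact (aboveA_add_le_aboveA hp (e := e) (f := ⟨(e.1.1, b), hE⟩) rfl (h b hb)).trans hsel.1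

theorem VotesForB.lt_posB (hB : ∀ b, G.StableVertex (Sum.inr b)) (hp : p ∈ G.polytopeC)
    (ht : 0 ≤ t) (ht' : t < 1) {e : G.Edge}
    (h : G.VotesForB (roundMatching p t) e.1.2 e.1.1) :
    aboveB p.1 e + p.1 e < posB p t e.1.2 := by
  obtain ⟨a, ha⟩ := exists_mem_roundMatching_right hB hp ht ht' e.1.2
  obtain ⟨hE, hsel⟩ := mem_roundMatching.1 ha
  exact (aboveB_add_le_aboveB hp (e := e) (f := ⟨(a, e.1.2), hE⟩) rfl (h a ha)).trans_lt
    ((selected_iff hB hp ht ht' _).1 hsel).1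

theorem votesAgainstA_of_posA_lt (hp : p ∈ G.polytopeC) {e : G.Edge}
    (hs : G.StableVertex (Sum.inl e.1.1)) (h : posA p t e.1.1 < aboveA p.1 e) :
    G.VotesAgainstA (roundMatching p t) e.1.1 e.1.2 := by
  obtain ⟨b, hb⟩ := exists_mem_roundMatching_left (t := t) hp hs
  obtain ⟨hE, hsel⟩ := mem_roundMatching.1 hb
  refine ⟨b, hb, ?_⟩
  by_contra! hle
  have : aboveA p.1 e ≤ aboveA p.1 ⟨(e.1.1, b), hE⟩ :=
    prefixSum_mono (fun f _ => polytopeC_nonneg hp f) hle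
  exact absurd (h.trans_le this) (not_lt.2 hsel.1)

theorem votesAgainstB_of_posB_le (hB : ∀ b, G.StableVertex (Sum.inr b)) (hp : p ∈ G.polytopeC)
    (ht : 0 ≤ t) (ht' : t < 1) {e : G.Edge} (h : posB p t e.1.2 ≤ aboveB p.1 e) :
    G.VotesAgainstB (roundMatching p t) e.1.2 e.1.1 := by
  obtain ⟨a, ha⟩ := exists_mem_roundMatching_right hB hp ht ht' e.1.2
  obtain ⟨hE, hsel⟩ := mem_roundMatching.1 ha
  refine ⟨a, ha, ?_⟩
  by_contra! hle
  have : aboveB p.1 e ≤ aboveB p.1 ⟨(a, e.1.2), hE⟩ :=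
    prefixSum_mono (fun f _ => polytopeC_nonneg hp f) hle
  exact absurd (h.trans this) (not_le.2 ((selected_iff hB hp ht ht' _).1 hsel).1)

theorem not_matched_roundMatching (hB : ∀ b, G.StableVertex (Sum.inr b)) (hp : p ∈ G.polytopeC)
    {a : A} (ha : ¬ G.StableVertex (Sum.inl a)) :
    ¬ Matched (roundMatching p t) (Sum.inl a) := by
  rintro ⟨b, hb⟩
  obtain ⟨hE, hsel⟩ := mem_roundMatching.1 hb
  exact ha (hsel.stableVertex hB hp)

/-- The cases are the signs of the two rounded multipliers. If they are opposite, the two positions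
add up to 2 minus both levels; a blocking edge would have both its cells end at or before these
positions, the one at b strictly, and `polytopeC_two_le` would give it negative weight. If both are
1, the bound 2 is trivial. -/
theorem wtM_roundMatching_le (hB : ∀ b, G.StableVertex (Sum.inr b)) (hp : p ∈ G.polytopeC)
    (ht : 0 ≤ t) (ht' : t < 1) (e : G.Edge) (hs : G.StableVertex (Sum.inl e.1.1)) :
    G.wtM (roundMatching p t) e.1.1 e.1.2 ≤
      roundWitness p t (Sum.inl e.1.1) + roundWitness p t (Sum.inr e.1.2) := by
  have h2 := polytopeC_two_le hB hp hs
  have hx := polytopeC_nonneg hp e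
  have hA := fract_sub_eq_ite ht ht' (level_nonneg hp (Sum.inl e.1.1)) (level_le_one hB hp _)
  have hB' := one_sub_fract_add_eq_ite ht ht' (level_nonneg hp (Sum.inr e.1.2))
    (level_le_one hB hp _)
  rw [← posA] at hA
  rw [← posB] at hB'
  have hblock : posA p t e.1.1 + posB p t e.1.2 =
      2 - level p (Sum.inl e.1.1) - level p (Sum.inr e.1.2) →
      G.wtM (roundMatching p t) e.1.1 e.1.2 ≤ 0 := fun h => by
    refine wtM_nonpos fun ⟨h3, h4⟩ => ?_
    have := h3.le_posA hp hs
    have := h4.lt_posB hB hp ht ht'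
    linarith
  simp only [roundWitness, if_pos hs]
  split_ifs at hA hB' ⊢
  · exact (hblock (by linarith)).trans (by norm_num)
  · exact (wtM_le_two _ _ _).trans (by norm_num)
  -- Both multipliers are -1. The positions now add up to only 1 minus both levels, so each precedes
  -- the cell of e and both ends prefer their assignments.
  · have h3 : 0 ≤ posA p t e.1.1 := Int.fract_nonneg _
    have h4 : 0 < posB p t e.1.2 := sub_pos.2 (Int.fract_lt_one _)
    have h5 := votesAgainstA_of_posA_lt (t := t) hp hs
      (by have := aboveB_add_le hB hp e; linarith)
    have h6 := votesAgainstB_of_posB_le hB hp ht ht' (e := e)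
      (by have := aboveA_add_le hp hs; linarith)
    have h7 : e.1 ∉ roundMatching p t := fun h =>
      ((isMatching_roundMatching hB hp ht ht').not_votes_of_mem h).2.1 h5
    rw [wtM, if_neg h7, if_neg fun h => h.1.not_against h5, if_pos ⟨h5, h6⟩]
    norm_num
  · exact (hblock (by linarith)).trans (by norm_num)

theorem isWitness_roundWitness (hB : ∀ b, G.StableVertex (Sum.inr b)) (hp : p ∈ G.polytopeC)
    (ht : 0 ≤ t) (ht' : t < 1) : G.IsWitness (roundMatching p t) (roundWitness p t) := by
  have hM := isMatching_roundMatching hB hp ht ht'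
  refine ⟨?_, ?_, fun a b hab => ?_, ?_⟩
  · rintro (a | b)
    · simp only [roundWitness]; split_ifs <;> simp
    · simp only [roundWitness]; split_ifs <;> simp
  · rw [hM.sum_eq, Finset.sum_eq_zero, Finset.sum_eq_zero, add_zero]
    · rintro (a | b) hu
      · have hu := (Finset.mem_filter.1 hu).2
        refine if_neg fun hs => hu ?_
        exact exists_mem_roundMatching_left hp hs
      · exact absurd (exists_mem_roundMatching_right hB hp ht ht' b) (Finset.mem_filter.1 hu).2
    -- The multipliers at the two ends of a selected edge are opposite.
    · rintro ⟨a, b⟩ he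
      obtain ⟨hE, hsel⟩ := mem_roundMatching.1 he
      have h := hsel.lt_iff_lt hB hp ht ht'
      simp only [roundWitness, if_pos (hsel.stableVertex hB hp)]
      simp only at h
      simp only [h]
      split_ifs <;> norm_num
  · by_cases hs : G.StableVertex (Sum.inl a)
    · exact wtM_roundMatching_le hB hp ht ht' ⟨(a, b), hab⟩ hs
    -- For unstable a the constraint reads `1 ≤ α b`, so b is rounded to 1 at every threshold.
    · have hlevel : ¬ t < 1 - level p (Sum.inr b) := by
        have h := hp.2.1 a b hab
        rw [cWt, if_neg hs, hp.2.2.2.1 _ hs] at h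
        unfold level
        linarith
      -- The selected edge at b lies in a dominant matching, which leaves a unmatched; hence b
      -- prefers its assignment to a.
      have hwt : G.wtM (roundMatching p t) a b ≤ 0 := by
        refine wtM_nonpos fun ⟨_, h⟩ => ?_
        obtain ⟨a', ha'⟩ := exists_mem_roundMatching_right hB hp ht ht' b
        obtain ⟨hE, hsel⟩ := mem_roundMatching.1 ha'
        obtain ⟨N, hN, hmem⟩ := hsel.dominantEdge hp
        exact (h a' ha').asymm
          (hN.1.rkB_lt hab (fun h => hs ((hN.1.matched_iff hB _).1 h)) hmem)
      simp only [roundWitness, if_neg hs, if_neg hlevel]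
      linarith
  · rintro (a | b)
    · unfold wtLoop
      by_cases hs : G.StableVertex (Sum.inl a)
      · have hm : Matched (roundMatching p t) (Sum.inl a) :=
          exists_mem_roundMatching_left hp hs
        simp only [roundWitness, if_pos hs, if_pos hm]
        split_ifs <;> norm_num
      · simp only [roundWitness, if_neg hs, if_neg (not_matched_roundMatching hB hp hs)]
        norm_num
    · have hm : Matched (roundMatching p t) (Sum.inr b) :=
        exists_mem_roundMatching_right hB hp ht ht' b
      simp only [wtLoop, roundWitness, if_pos hm]
      split_ifs <;> norm_num

/-- The pair of the rounded matching and its witness. -/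
noncomputable def roundPair (p : (G.Edge → ℝ) × (A ⊕ B → ℝ)) (t : ℝ) :
    (G.Edge → ℝ) × (A ⊕ B → ℝ) :=
  (G.incidence (roundMatching p t), roundWitness p t)

end MarriageInstance

/-! ### Averaging over thresholds -/

section Average

open MeasureTheory

/-- The integrand has period 1, so the shift by q is immaterial, and on [0, 1) the fractional part
is the identity. -/
theorem integral_indicator_fract {q c x : ℝ} (hc : 0 ≤ c) (hx : 0 ≤ x) (h : c + x ≤ 1) :
    ∫ t in Set.Ico (0 : ℝ) 1, Set.indicator (Set.Ico c (c + x)) 1 (Int.fract (t - q)) = x := by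
  have hper : Function.Periodic
      (fun t : ℝ => Set.indicator (Set.Ico c (c + x)) (1 : ℝ → ℝ) (Int.fract t)) 1 := fun t => by
    simp only [Int.fract_add_one]
  rw [integral_Ico_eq_integral_Ioc, ← intervalIntegral.integral_of_le zero_le_one,
    intervalIntegral.integral_comp_sub_right
      (fun t => Set.indicator (Set.Ico c (c + x)) (1 : ℝ → ℝ) (Int.fract t)) q,
    show (1 : ℝ) - q = 0 - q + 1 by ring, hper.intervalIntegral_add_eq (0 - q) 0, zero_add,
    intervalIntegral.integral_of_le zero_le_one, ← integral_Ico_eq_integral_Ioc]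
  have h1 : Set.EqOn (fun t : ℝ => Set.indicator (Set.Ico c (c + x)) (1 : ℝ → ℝ) (Int.fract t))
      (Set.indicator (Set.Ico c (c + x)) 1) (Set.Ico 0 1) := fun t ht => by
    simp only [Int.fract_eq_self.2 ht]
  rw [setIntegral_congr_fun measurableSet_Ico h1, setIntegral_indicator measurableSet_Ico,
    Set.inter_eq_right.2 (Set.Ico_subset_Ico hc h)]
  simp [hx]

theorem integral_ite_lt {c y z : ℝ} (hc : 0 ≤ c) (hc' : c ≤ 1) :
    ∫ t in Set.Ico (0 : ℝ) 1, (if t < c then y else z) = c * y + (1 - c) * z := by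
  rw [← Set.Ico_union_Ico_eq_Ico hc hc', setIntegral_union (Set.Ico_disjoint_Ico_same)
    measurableSet_Ico]
  · have h1 : Set.EqOn (fun t : ℝ => if t < c then y else z) (fun _ => y) (Set.Ico 0 c) :=
      fun t ht => if_pos ht.2
    have h2 : Set.EqOn (fun t : ℝ => if t < c then y else z) (fun _ => z) (Set.Ico c 1) :=
      fun t ht => if_neg (not_lt.2 ht.1)
    rw [setIntegral_congr_fun measurableSet_Ico h1, setIntegral_congr_fun measurableSet_Ico h2]
    simp [hc, hc']
  · refine IntegrableOn.congr_fun (f := fun _ => y) ?_ (fun t ht => (if_pos ht.2).symm)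
      measurableSet_Ico
    simp
  · refine IntegrableOn.congr_fun (f := fun _ => z) ?_ (fun t ht => (if_neg (not_lt.2 ht.1)).symm)
      measurableSet_Ico
    simp

namespace MarriageInstance

variable {A : Type*} {B : Type*} {G : MarriageInstance A B}
  {p : (G.Edge → ℝ) × (A ⊕ B → ℝ)}

theorem measurable_roundPair (p : (G.Edge → ℝ) × (A ⊕ B → ℝ)) :
    Measurable (roundPair p) := by
  refine Measurable.prodMk (measurable_pi_lambda _ fun e => ?_) (measurable_pi_lambda _ ?_)
  · simp only [incidence_roundMatching]
    refine (measurable_one.indicator measurableSet_Ico).comp ?_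
    exact measurable_fract.comp (measurable_id.sub_const _)
  · rintro (a | b)
    · simp only [roundWitness]
      split_ifs
      · exact Measurable.ite measurableSet_Iio measurable_const measurable_const
      · exact measurable_const
    · exact Measurable.ite measurableSet_Iio measurable_const measurable_const

variable [Fintype A] [Fintype B]

theorem norm_roundPair_le (p : (G.Edge → ℝ) × (A ⊕ B → ℝ)) (t : ℝ) :
    ‖roundPair p t‖ ≤ 1 := by
  refine norm_prod_le_iff.2 ⟨(pi_norm_le_iff_of_nonneg zero_le_one).2 fun e => ?_,
    (pi_norm_le_iff_of_nonneg zero_le_one).2 ?_⟩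
  · simp only [roundPair, incidence]
    split_ifs <;> simp
  · rintro (a | b)
    · simp only [roundPair, roundWitness]
      split_ifs <;> simp
    · simp only [roundPair, roundWitness]
      split_ifs <;> simp

theorem integrable_roundPair (p : (G.Edge → ℝ) × (A ⊕ B → ℝ)) :
    IntegrableOn (roundPair p) (Set.Ico (0 : ℝ) 1) :=
  Measure.integrableOn_of_bounded (M := 1) (by simp)
    (measurable_roundPair p).aestronglyMeasurable
    (Filter.Eventually.of_forall (norm_roundPair_le p))

/-- A point of the polytope is the average of its roundings. -/
theorem integral_roundPair (hB : ∀ b, G.StableVertex (Sum.inr b)) (hp : p ∈ G.polytopeC) :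
    ∫ t in Set.Ico (0 : ℝ) 1, roundPair p t = p := by
  have hint := integrable_roundPair p
  refine Prod.ext (funext fun e => ?_) (funext fun u => ?_)
  · have := ContinuousLinearMap.integral_comp_comm
      ((ContinuousLinearMap.proj (R := ℝ) (φ := fun _ : G.Edge => ℝ) e).comp
        (ContinuousLinearMap.fst ℝ (G.Edge → ℝ) (A ⊕ B → ℝ))) hint
    refine this.symm.trans ?_
    change ∫ t in Set.Ico (0 : ℝ) 1, G.incidence (roundMatching p t) e = p.1 e
    simp only [incidence_roundMatching, posA]
    by_cases hs : G.StableVertex (Sum.inl e.1.1)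
    · exact integral_indicator_fract (aboveA_nonneg hp e) (polytopeC_nonneg hp e)
        (aboveA_add_le hp hs)
    · simp [polytopeC_eq_zero hB hp hs]
  · have := ContinuousLinearMap.integral_comp_comm
      ((ContinuousLinearMap.proj (R := ℝ) (φ := fun _ : A ⊕ B => ℝ) u).comp
        (ContinuousLinearMap.snd ℝ (G.Edge → ℝ) (A ⊕ B → ℝ))) hint
    refine this.symm.trans ?_
    change ∫ t in Set.Ico (0 : ℝ) 1, roundWitness p t u = p.2 u
    have h0 := level_nonneg hp u
    have h1 := level_le_one hB hp u
    cases u with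
    | inl a =>
      simp only [roundWitness]
      split_ifs with hs
      · rw [integral_ite_lt h0 h1, level]
        ring
      · rw [hp.2.2.2.1 _ hs]
        simp
    | inr b =>
      simp only [roundWitness]
      rw [integral_ite_lt (by linarith) (by linarith), level]
      ring

end MarriageInstance

end Average

/-! ### Linear descriptions -/

section LinearDescription

variable {X : Type*} [AddCommGroup X] [Module ℝ X]

theorem HasLinearDescription.mono {Q : Set X} {M N : ℕ} (h : HasLinearDescription Q M)
    (hMN : M ≤ N) : HasLinearDescription Q N := by
  obtain ⟨k, l, f, c, g, d, hkl, hQ⟩ := h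
  exact ⟨k, l, f, c, g, d, hkl.trans hMN, hQ⟩

theorem HasLinearDescription.convex {Q : Set X} {N : ℕ} (h : HasLinearDescription Q N) :
    Convex ℝ Q := by
  obtain ⟨k, l, f, c, g, d, -, rfl⟩ := h
  simp only [Set.ofPred_and, Set.ofPred_forall]
  exact (convex_iInter fun i => convex_halfSpace_ge (f i).isLinear (c i)).inter
    (convex_iInter fun j => convex_hyperplane (g j).isLinear (d j))

theorem hasLinearDescription_univ : HasLinearDescription (Set.univ : Set X) 0 :=
  ⟨0, 0, Fin.elim0, Fin.elim0, Fin.elim0, Fin.elim0, le_rfl, by ext; simp⟩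

theorem HasLinearDescription.inter {Q R : Set X} {M N : ℕ} (hQ : HasLinearDescription Q M)
    (hR : HasLinearDescription R N) : HasLinearDescription (Q ∩ R) (M + N) := by
  obtain ⟨k, l, f, c, g, d, hkl, rfl⟩ := hQ
  obtain ⟨k', l', f', c', g', d', hkl', rfl⟩ := hR
  refine ⟨k + k', l + l', Fin.append f f', Fin.append c c', Fin.append g g', Fin.append d d',
    by omega, ?_⟩
  ext p
  simp only [Set.mem_inter_iff, Set.mem_ofPred_eq, Fin.forall_fin_add, Fin.append_left,
    Fin.append_right]
  tauto

theorem HasLinearDescription.forall {ι : Type*} [Fintype ι] {Q : ι → X → Prop}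
    (h : ∀ i, HasLinearDescription {p | Q i p} 1) :
    HasLinearDescription {p | ∀ i, Q i p} (Fintype.card ι) := by
  suffices h : ∀ s : Finset ι, HasLinearDescription {p | ∀ i ∈ s, Q i p} s.card by
    simpa using h Finset.univ
  intro s
  induction s using Finset.induction_on with
  | empty => simpa using hasLinearDescription_univ
  | insert i s hi ih =>
    rw [Finset.card_insert_of_notMem hi, add_comm]
    convert (h i).inter ih using 1
    ext p
    simp

theorem HasLinearDescription.imp {Q : X → Prop} {N : ℕ} (c : Prop)
    (h : HasLinearDescription {p | Q p} N) : HasLinearDescription {p | c → Q p} N := by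
  by_cases hc : c
  · simpa [hc] using h
  · simpa [hc] using hasLinearDescription_univ.mono (Nat.zero_le N)

/-- An affine function on a real vector space, given as a linear functional up to a constant. -/
def IsAffineFun (h : X → ℝ) : Prop := ∃ (f : X →ₗ[ℝ] ℝ) (c : ℝ), ∀ p, h p = f p + c

theorem IsAffineFun.const (c : ℝ) : IsAffineFun fun _ : X => c := ⟨0, c, by simp⟩

theorem IsAffineFun.linear (f : X →ₗ[ℝ] ℝ) : IsAffineFun f := ⟨f, 0, by simp⟩

theorem IsAffineFun.add {h h' : X → ℝ} (H : IsAffineFun h) (H' : IsAffineFun h') :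
    IsAffineFun fun p => h p + h' p := by
  obtain ⟨f, c, hf⟩ := H
  obtain ⟨f', c', hf'⟩ := H'
  exact ⟨f + f', c + c', fun p => by simp only [hf, hf', LinearMap.add_apply]; ring⟩

theorem IsAffineFun.sub {h h' : X → ℝ} (H : IsAffineFun h) (H' : IsAffineFun h') :
    IsAffineFun fun p => h p - h' p := by
  obtain ⟨f, c, hf⟩ := H
  obtain ⟨f', c', hf'⟩ := H'
  exact ⟨f - f', c - c', fun p => by simp only [hf, hf', LinearMap.sub_apply]; ring⟩

theorem IsAffineFun.sum {ι : Type*} (s : Finset ι) {h : ι → X → ℝ}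
    (H : ∀ i, IsAffineFun (h i)) : IsAffineFun fun p => ∑ i ∈ s, h i p := by
  choose f c hf using H
  exact ⟨∑ i ∈ s, f i, ∑ i ∈ s, c i, fun p => by simp [hf, Finset.sum_add_distrib]⟩

theorem IsAffineFun.le {h h' : X → ℝ} (H : IsAffineFun h) (H' : IsAffineFun h') :
    HasLinearDescription {p | h p ≤ h' p} 1 := by
  obtain ⟨f, c, hf⟩ := H'.sub H
  refine ⟨1, 0, fun _ => f, fun _ => -c, Fin.elim0, Fin.elim0, le_rfl, ?_⟩
  ext p
  have := hf p
  simp only [Set.mem_ofPred_eq, forall_const, IsEmpty.forall_iff, and_true]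
  constructor <;> intro h <;> linarith

theorem IsAffineFun.eq {h h' : X → ℝ} (H : IsAffineFun h) (H' : IsAffineFun h') :
    HasLinearDescription {p | h p = h' p} 1 := by
  obtain ⟨f, c, hf⟩ := H.sub H'
  refine ⟨0, 1, Fin.elim0, Fin.elim0, fun _ => f, fun _ => -c, le_rfl, ?_⟩
  ext p
  have := hf p
  simp only [Set.mem_ofPred_eq, forall_const, IsEmpty.forall_iff, true_and]
  constructor <;> intro h <;> linarith

end LinearDescription

namespace MarriageInstance

variable {A : Type*} {B : Type*} {G : MarriageInstance A B}

theorem isAffineFun_fst (e : G.Edge) :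
    IsAffineFun fun p : (G.Edge → ℝ) × (A ⊕ B → ℝ) => p.1 e :=
  .linear ((LinearMap.proj (R := ℝ) (φ := fun _ : G.Edge => ℝ) e).comp
    (LinearMap.fst ℝ (G.Edge → ℝ) (A ⊕ B → ℝ)))

theorem isAffineFun_snd (u : A ⊕ B) :
    IsAffineFun fun p : (G.Edge → ℝ) × (A ⊕ B → ℝ) => p.2 u :=
  .linear ((LinearMap.proj (R := ℝ) (φ := fun _ : A ⊕ B => ℝ) u).comp
    (LinearMap.snd ℝ (G.Edge → ℝ) (A ⊕ B → ℝ)))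

theorem isAffineFun_cWt (a : A) (b : B) :
    IsAffineFun fun p : (G.Edge → ℝ) × (A ⊕ B → ℝ) => G.cWt p.1 a b := by
  have hsum : ∀ s : Finset G.Edge,
      IsAffineFun fun p : (G.Edge → ℝ) × (A ⊕ B → ℝ) => ∑ e ∈ s, p.1 e :=
    fun s => .sum s isAffineFun_fst
  unfold cWt
  split_ifs
  · exact ((((IsAffineFun.const 1).sub (hsum _)).add (hsum _)).sub (hsum _)).add
      ((((IsAffineFun.const 1).sub (hsum _)).add (hsum _)).sub (hsum _))
  · exact .const 1

variable [Fintype A] [Fintype B]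

theorem hasLinearDescription_polytopeC :
    HasLinearDescription G.polytopeC (3 * G.E.card + 4 * Fintype.card (A ⊕ B)) := by
  -- One equation is charged as n, since the bound has no additive constant; with no vertices the
  -- equation is void.
  have h1 : HasLinearDescription
      {p : (G.Edge → ℝ) × (A ⊕ B → ℝ) | ∑ u, p.2 u = 0} (Fintype.card (A ⊕ B)) := by
    rcases isEmpty_or_nonempty (A ⊕ B) with h | h
    · simpa using hasLinearDescription_univ
    · exact ((IsAffineFun.sum _ isAffineFun_snd).eq (.const 0)).mono Fintype.card_pos
  have h2 := HasLinearDescription.forall (X := (G.Edge → ℝ) × (A ⊕ B → ℝ)) (ι := G.Edge)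
    fun e => (isAffineFun_cWt e.1.1 e.1.2).le
      ((isAffineFun_snd (Sum.inl e.1.1)).add (isAffineFun_snd (Sum.inr e.1.2)))
  have h3 := HasLinearDescription.forall fun u => (IsAffineFun.const (-1)).le
    (isAffineFun_snd (G := G) u)
  have h4 := HasLinearDescription.forall fun u => ((isAffineFun_snd (G := G) u).eq
    (IsAffineFun.const 0)).imp (¬ G.StableVertex u)
  have h5 := HasLinearDescription.forall fun u => ((IsAffineFun.sum (G.delta u)
    isAffineFun_fst).eq (IsAffineFun.const 1)).imp (G.StableVertex u)
  have h6 := HasLinearDescription.forall fun e : G.Edge => ((isAffineFun_fst e).eq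
    (IsAffineFun.const 0)).imp (¬ G.DominantEdge e.1)
  have h7 := HasLinearDescription.forall fun e : G.Edge => ((IsAffineFun.const 0).le
    (isAffineFun_fst e)).imp (G.DominantEdge e.1)
  have hE : Fintype.card G.Edge = G.E.card := Fintype.card_coe _
  rw [hE] at h2 h6 h7
  convert (h1.inter (h2.inter (h3.inter (h4.inter (h5.inter (h6.inter h7)))))).mono ?_ using 1
  · ext p
    simp only [polytopeC, Set.mem_inter_iff, Set.mem_ofPred_eq, Subtype.forall, Prod.forall]
  · omega

/-! ### The polytope of the extra-dominant matchings -/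

variable {P : G.Pairing}

theorem Pairing.extraDominantPairs_subset : P.extraDominantPairs ⊆ P.polytopeF := by
  rintro ⟨x, α⟩ ⟨T, hT, hα, rfl⟩
  exact ⟨hα.1.mem_polytopeC P.stableVertex_inr hT.1 fun u hu =>
    hα.2.1 u ((popularVertex_iff P.stableVertex_inr u).2 hu), hα.2.2⟩

/-- Rounding stays in the face: a multiplier -1 has level 0, so no threshold rounds it up. -/
theorem Pairing.roundPair_mem {p : (P.augment.Edge → ℝ) × (A ⊕ B → ℝ)} (hp : p ∈ P.polytopeF)
    {t : ℝ} (ht : 0 ≤ t) (ht' : t < 1) : roundPair p t ∈ P.extraDominantPairs := by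
  have hB := P.stableVertex_inr
  have hw := isWitness_roundWitness hB hp.1 ht ht'
  have hM := isMatching_roundMatching hB hp.1 ht ht'
  have hed : P.IsExtraDominantWitness (roundMatching p t) (roundWitness p t) := by
    refine ⟨hw, ?_, fun a ha => ?_⟩
    · rintro (a | b) hv
      · rw [popularVertex_iff hB] at hv
        simp only [roundWitness, if_pos hv]
        split_ifs <;> simp
      · simp only [roundWitness]
        split_ifs <;> simp
    · have h : ¬ t < level p (Sum.inl a) := by
        rw [level, hp.2 a ha]
        linarith
      simp only [roundWitness, if_pos ha.2, if_neg h]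
  exact ⟨_, ⟨hw.isPopular hM, _, hed⟩, hed, rfl⟩

theorem Pairing.finite_extraDominantPairs (P : G.Pairing) : P.extraDominantPairs.Finite := by
  have hfin : (Set.pi Set.univ (fun _ : P.augment.Edge => ({0, 1} : Set ℝ)) ×ˢ
      Set.pi Set.univ (fun _ : A ⊕ B => ({0, 1, -1} : Set ℝ))).Finite :=
    (Set.Finite.pi fun _ => Set.toFinite _).prod (Set.Finite.pi fun _ => Set.toFinite _)
  refine hfin.subset ?_
  rintro ⟨x, α⟩ ⟨T, -, hα, rfl⟩
  refine ⟨fun e _ => ?_, fun u _ => by simpa using hα.1.1 u⟩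
  simp only [incidence]
  split_ifs <;> simp

theorem Pairing.hasLinearDescription_polytopeF (P : G.Pairing) : HasLinearDescription P.polytopeF
    (3 * P.augment.E.card + 5 * Fintype.card (A ⊕ B)) := by
  have h := HasLinearDescription.forall fun a => ((isAffineFun_snd (G := P.augment)
    (Sum.inl a)).eq (IsAffineFun.const (-1))).imp (P.NewlyStable a)
  refine ((hasLinearDescription_polytopeC (G := P.augment)).inter h).mono ?_
  rw [Fintype.card_sum]
  omega

/-- A point of F is the mean of its roundings under uniform t. The hull of a finite set is closed
and convex, so it contains the mean of points lying in it. -/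
theorem Pairing.polytopeF_eq : P.polytopeF = convexHull ℝ P.extraDominantPairs := by
  refine Set.Subset.antisymm (fun p hp => ?_)
    (convexHull_min extraDominantPairs_subset P.hasLinearDescription_polytopeF.convex)
  have hprob : MeasureTheory.IsProbabilityMeasure
      (MeasureTheory.volume.restrict (Set.Ico (0 : ℝ) 1)) := ⟨by simp⟩
  rw [← integral_roundPair P.stableVertex_inr hp.1]
  refine (convex_convexHull ℝ _).integral_mem
    (P.finite_extraDominantPairs.isClosed_convexHull ℝ) ?_
    (integrable_roundPair p)
  refine (MeasureTheory.ae_restrict_mem measurableSet_Ico).mono fun t ht => ?_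
  exact subset_convexHull ℝ _ (roundPair_mem hp ht.1 ht.2)

/-- Each pair has entries 0 or 1 on edges, ±1 on stable vertices and 0 on unstable ones, so it is a
corner of a box containing the hull, and therefore extreme in the hull. -/
theorem Pairing.extremePoints_polytopeF :
    Set.extremePoints ℝ P.polytopeF = P.extraDominantPairs := by
  rw [polytopeF_eq]
  refine Set.Subset.antisymm (extremePoints_convexHull_subset (𝕜 := ℝ)) fun p hp => ?_
  let box : Set ((P.augment.Edge → ℝ) × (A ⊕ B → ℝ)) :=
    Set.pi Set.univ (fun _ => Set.Icc 0 1) ×ˢ Set.pi Set.univ (fun u =>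
      if P.augment.StableVertex u then Set.Icc (-1) 1 else Set.Icc 0 0)
  have hext : Set.extremePoints ℝ box =
      Set.pi Set.univ (fun _ => {0, 1}) ×ˢ Set.pi Set.univ (fun u =>
        if P.augment.StableVertex u then {-1, 1} else {0}) := by
    rw [extremePoints_prod, extremePoints_pi, extremePoints_pi]
    congr 2
    · funext e
      exact Set.extremePoints_Icc zero_le_one
    · funext u
      split_ifs
      · exact Set.extremePoints_Icc (by norm_num)
      · rw [Set.extremePoints_Icc le_rfl]
        simp
  have hsub : P.extraDominantPairs ⊆ Set.extremePoints ℝ box := by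
    rw [hext]
    rintro ⟨x, α⟩ ⟨T, hT, hα, rfl⟩
    refine ⟨fun e _ => ?_, fun u _ => ?_⟩
    · simp only [incidence]
      split_ifs <;> simp
    · simp only
      split_ifs with hu
      · exact (hα.2.1 u ((popularVertex_iff P.stableVertex_inr u).2 hu)).symm
      · exact hα.1.eq_zero_of_not_matched hT.1.1
          fun h => hu ((hT.1.matched_iff P.stableVertex_inr u).1 h)
  have hconv : Convex ℝ box := by
    refine (convex_pi fun _ _ => convex_Icc _ _).prod (convex_pi fun u _ => ?_)
    split_ifs <;> exact convex_Icc _ _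
  exact inter_extremePoints_subset_extremePoints_of_subset (𝕜 := ℝ) (A := box)
    (convexHull_min (hsub.trans extremePoints_subset) hconv)
    ⟨subset_convexHull ℝ _ hp, hsub hp⟩

/-- Since every multiplier is at least -1, minus the sum over newly stable vertices is maximal
exactly when all of these equal -1, as soon as some point of C attains this. -/
theorem Pairing.isExposed_polytopeF : IsExposed ℝ P.augment.polytopeC P.polytopeF := by
  rintro ⟨p₀, hp₀⟩
  let l : ((P.augment.Edge → ℝ) × (A ⊕ B → ℝ)) →L[ℝ] ℝ :=
    -∑ a with P.NewlyStable a,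
      (ContinuousLinearMap.proj (R := ℝ) (φ := fun _ : A ⊕ B => ℝ) (Sum.inl a)).comp
        (ContinuousLinearMap.snd ℝ (P.augment.Edge → ℝ) (A ⊕ B → ℝ))
  have hl : ∀ p, l p = -∑ a with P.NewlyStable a, p.2 (Sum.inl a) := fun p => by
    simp [l]
  refine ⟨l, ?_⟩
  ext p
  refine and_congr_right fun hp => ⟨fun h q hq => ?_, fun h => ?_⟩
  · rw [hl, hl, neg_le_neg_iff]
    refine Finset.sum_le_sum fun a ha => ?_
    rw [h a (Finset.mem_filter.1 ha).2]
    exact hq.2.2.1 _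
  · have h1 := h p₀ hp₀.1
    rw [hl, hl, neg_le_neg_iff] at h1
    have h2 : ∑ a with P.NewlyStable a, p₀.2 (Sum.inl a) =
        ∑ a with P.NewlyStable a, (-1 : ℝ) :=
      Finset.sum_congr rfl fun a ha => hp₀.2 a (Finset.mem_filter.1 ha).2
    rw [h2] at h1
    have h3 : ∀ a ∈ Finset.univ.filter P.NewlyStable, (-1 : ℝ) ≤ p.2 (Sum.inl a) :=
      fun a _ => hp.2.2.1 _
    have h4 := (Finset.sum_eq_sum_iff_of_le h3).1 (le_antisymm (Finset.sum_le_sum h3) h1)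
    exact fun a ha => (h4 a (Finset.mem_filter.2 ⟨Finset.mem_univ a, ha⟩)).symm

theorem Pairing.image_fst_polytopeF : Prod.fst '' P.polytopeF = P.extraDominantPolytope := by
  rw [polytopeF_eq, extraDominantPolytope]
  refine ((LinearMap.fst ℝ (P.augment.Edge → ℝ) (A ⊕ B → ℝ)).image_convexHull _).trans ?_
  congr 1
  ext x
  constructor
  · rintro ⟨p, ⟨T, hT, -, hx⟩, rfl⟩
    exact ⟨T, hT, hx⟩
  · rintro ⟨T, hT, rfl⟩
    obtain ⟨α, hα⟩ := hT.2
    exact ⟨(_, α), ⟨T, hT, hα, rfl⟩, rfl⟩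

end MarriageInstance

/-! ### The main theorem -/

theorem mainTheorem6 :
    ∃ K : ℕ, ∀ (A : Type*) (B : Type*) [Fintype A] [Fintype B] (G : MarriageInstance A B)
      (P : G.Pairing), Fintype.card B ≤ Fintype.card A →
      -- the polytope is the indicated face
      P.polytopeF = {p ∈ P.augment.polytopeC | ∀ a, P.NewlyStable a → p.2 (Sum.inl a) = -1} ∧
      IsExposed ℝ P.augment.polytopeC P.polytopeF ∧
      -- it is an integral polytope, with explicitly known vertices
      P.polytopeF = convexHull ℝ P.extraDominantPairs ∧
      Set.extremePoints ℝ P.polytopeF = P.extraDominantPairs ∧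
      (∀ p ∈ Set.extremePoints ℝ P.polytopeF,
        (∀ e, ∃ z : ℤ, p.1 e = z) ∧ ∀ u, ∃ z : ℤ, p.2 u = z) ∧
      -- it projects onto the extra-dominant matching polytope
      Prod.fst '' P.polytopeF = P.extraDominantPolytope ∧
      -- size
      P.augment.E.card + Fintype.card (A ⊕ B) ≤ K * (G.E.card + Fintype.card (A ⊕ B)) ∧
      HasLinearDescription P.polytopeF (K * (G.E.card + Fintype.card (A ⊕ B))) := by
  -- The description has size at most 3|E*| + 5n, and |E*| ≤ m + n turns this into 3m + 8n.
  refine ⟨8, fun A B _ _ G P _ => ⟨rfl, P.isExposed_polytopeF, P.polytopeF_eq,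
    P.extremePoints_polytopeF, ?_, P.image_fst_polytopeF, ?_,
    P.hasLinearDescription_polytopeF.mono ?_⟩⟩
  · rw [P.extremePoints_polytopeF]
    rintro ⟨x, α⟩ ⟨T, -, hα, rfl⟩
    refine ⟨fun e => ?_, fun u => ?_⟩
    · by_cases he : e.1 ∈ T
      · exact ⟨1, by simp [MarriageInstance.incidence, he]⟩
      · exact ⟨0, by simp [MarriageInstance.incidence, he]⟩
    · rcases hα.1.1 u with h | h | h
      · exact ⟨0, by simpa using h⟩
      · exact ⟨1, by simpa using h⟩
      · exact ⟨-1, by simpa using h⟩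
  · have := P.card_augment_le
    omega
  · have := P.card_augment_le
    omega
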